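/- Let $\mathbb{H}^3=\{x\in\mathbb{L}^4 : \langle x,x\rangle=-1,\ x_0>0\}$, where $\mathbb{L}^4=\mathbb{R}^4$ carries $\langle x,y\rangle=-x_0y_0+x_1y_1+x_2y_2+x_3y_3$ and is identified with the Hermitian $2\times 2$ matrices by $x\mapsto\begin{pmatrix}x_0+x_3&x_1+ix_2\\x_1-ix_2&x_0-x_3\end{pmatrix}$; $\mathrm{SL}(2,\mathbb{C})$ acts by isometries $p\mapsto apa^*$. Let $L\mathbb{H}^3$ be the space of oriented geodesics, i.e. of unit speed geodesics $\gamma:\mathbb{R}\to\mathbb{H}^3$ modulo shifts of the parameter. On the set $\mathcal{U}$ of oriented geodesics whose endpoints in $\partial\mathbb{H}^3=\mathbb{C}\cup\{\infty\}$ (upper half-space model, $w=(x_1+ix_2)/(x_0-x_3)$, $r=1/(x_0-x_3)$) satisfy $\gamma_+\ne 0$, $\gamma_-\neq\infty$, use the coordinates $\mu_1=-\gamma_-$, $\mu_2=1/\overline{\gamma_+}$; they range over $\{(\mu_1,\mu_2)\in\mathbb{C}^2 : 1+\mu_1\bar\mu_2\neq 0\}$. Let $\mathcal{G}^{\mathfrak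 r}$ and $\mathcal{G}^{\mathfrak i}$ be the real and imaginary parts of $\mathcal{G}=4\,d\mu_1d\bar\mu_2/(1+\mu_1\bar\mu_2)^2$; they are $\mathrm{SL}(2,\mathbb{C})$-invariant and so define neutral metrics on $L\mathbb{H}^3$. A null-causal curve is a smooth regular curve $\alpha$ on an open interval with $\mathcal{G}^{\mathfrak i}(\alpha',\alpha')=0$ and $\mathcal{G}^{\mathfrak r}(\alpha',\alpha')\le 0$ everywhere. A developable surface is a smooth immersion $f:\Sigma\to\mathbb{H}^3$ of a $2$-manifold with vanishing extrinsic curvature that is ruled: around every point there are coordinates $(s,t)$ in which $f=c(s)\cosh t+v(s)\sinh t$, with $c$ a curve in $\mathbb{H}^3$ and $v$ a unit normal vector field along $c$. It is generated by complete geodesics if these coordinates can be chosen to range over $J\times\mathbb{R}$, $J$ an open interval. 1. Let $\alpha(s)=(\mu_1(s),\mu_2(s))$, $s\in I$, be a null-causal curve in $\mathcal{U}$. Then $$f(s,t)=\frac{1}{|1+\mu_1(s)\bar\mu_2(s)|}\begin{pmatrix}e^t+e^{-t}|\mu_1(s)|^2&e^t\mu_2(s)-e^{-t}\mu_1(s)\\e^t\bar\mu_2(s)-e^{-t}\bar\mu_1(s)&e^t|\mu_2(s)|^2+e^{-t}\end{pmatrix},\qquad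 (s,t)\in I\times\mathbb{R},$$ is a developable surface generated by complete geodesics, and for each $s$ the curve $t\mapsto f(s,t)$ is a unit speed geodesic with coordinates $(\mu_1(s),\mu_2(s))$. 2. More generally, let $\alpha:I\to L\mathbb{H}^3$ be any null-causal curve. Then there is a smooth map $f$ on $I\times\mathbb{R}$ such that, for each $s\in I$, $t\mapsto f(s,t)$ is a unit speed geodesic representing $\alpha(s)$, and every such $f$ is a developable surface generated by complete geodesics. 3. Conversely, let $f:\Sigma\to\mathbb{H}^3$ be a developable surface generated by complete geodesics. Then every point of $\Sigma$ has a coordinate neighbourhood with coordinates $(s,t)\in I\times\mathbb{R}$, $I$ an open interval, such that $t\mapsto f(s,t)$ represents $\alpha(s)$ for some null-causal curve $\alpha:I\to L\mathbb{H}^3$. Moreover, up to an isometry $p\mapsto apa^*$ with $a\in\mathrm{SL}(2,\mathbb{C})$, $f(s,t)$ is given there by the formula of part 1 for a null-causal curve $(\mu_1(s),\mu_2(s))$ in $\mathcal{U}$. -/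

import Mathlib

open scoped Manifold ContDiff Topology ComplexConjugate MatrixGroups

noncomputable section

/-! ### Hyperbolic space -/

/-- The vector space of Lorentz-Minkowski `4`-space, with coordinates `x₀, x₁, x₂, x₃`. -/
abbrev Mink4 : Type := Fin 4 → ℝ

/-- The Lorentz metric. -/
def lorentz (x y : Mink4) : ℝ := -(x 0 * y 0) + x 1 * y 1 + x 2 * y 2 + x 3 * y 3

/-- The identification of Lorentz-Minkowski space with the Hermitian `2 × 2` matrices. -/
def toHerm (x : Mink4) : Matrix (Fin 2) (Fin 2) ℂ :=
  !![((x 0 + x 3 : ℝ) : ℂ), (x 1 : ℂ) + Complex.I * (x 2 : ℂ);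
    (x 1 : ℂ) - Complex.I * (x 2 : ℂ), ((x 0 - x 3 : ℝ) : ℂ)]

/-- The inverse identification (it is only used for Hermitian matrices). -/
def ofHerm (X : Matrix (Fin 2) (Fin 2) ℂ) : Mink4 :=
  ![((X 0 0).re + (X 1 1).re) / 2, (X 0 1).re, (X 0 1).im, ((X 0 0).re - (X 1 1).re) / 2]

/-- Hyperbolic `3`-space. -/
def Hyp3 : Set Mink4 := {x | lorentz x x = -1 ∧ 0 < x 0}

/-- The unit tangent bundle of hyperbolic `3`-space. -/
def UnitTangent3 : Set (Mink4 × Mink4) :=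
  {u | u.1 ∈ Hyp3 ∧ lorentz u.2 u.2 = 1 ∧ lorentz u.1 u.2 = 0}

/-- The isometric action `X ↦ a X a*` of `SL(2, ℂ)`. -/
def isomAct (a : SL(2, ℂ)) (x : Mink4) : Mink4 :=
  ofHerm ((a : Matrix (Fin 2) (Fin 2) ℂ) * toHerm x *
    (a : Matrix (Fin 2) (Fin 2) ℂ).conjTranspose)

/-- The curve `t ↦ p cosh t + v sinh t`. -/
def geodesicCurve (p v : Mink4) (t : ℝ) : Mink4 := Real.cosh t • p + Real.sinh t • v

/-- Unit speed geodesics `ℝ → ℍ³` (they are complete). -/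
def IsUnitSpeedGeodesic (γ : ℝ → Mink4) : Prop :=
  ∃ p v : Mink4, (p, v) ∈ UnitTangent3 ∧ ∀ t, γ t = geodesicCurve p v t

/-! ### The space of oriented geodesics -/

/-- Two unit speed geodesics are equivalent when they differ by a shift of the parameter. -/
def geodesicSetoid : Setoid {γ : ℝ → Mink4 // IsUnitSpeedGeodesic γ} where
  r γ₁ γ₂ := ∃ t₀ : ℝ, ∀ t, γ₁.1 (t + t₀) = γ₂.1 t
  iseqv :=
    { refl := fun _ => ⟨0, fun t => by rw [add_zero]⟩
      symm := by
        rintro γ₁ γ₂ ⟨t₀, h⟩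
        exact ⟨-t₀, fun t => by rw [← h, neg_add_cancel_right]⟩
      trans := by
        rintro γ₁ γ₂ γ₃ ⟨t₀, h⟩ ⟨t₁, k⟩
        exact ⟨t₁ + t₀, fun t => by rw [← k, ← h, add_assoc]⟩ }

/-- The space of oriented geodesics of `ℍ³`. -/
def OrientedGeodesics : Type := Quotient geodesicSetoid

/-- `γ` is a unit speed geodesic and its class is `ℓ`. -/
def Represents (γ : ℝ → Mink4) (ℓ : OrientedGeodesics) : Prop :=
  ∃ h : IsUnitSpeedGeodesic γ, (Quotient.mk geodesicSetoid ⟨γ, h⟩ : OrientedGeodesics) = ℓ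

/-- The isometry of `ℍ³` with the upper half-space `{(w, r) | r > 0}`:
`(w, r) = ((x₁ + i x₂) / (x₀ - x₃), 1 / (x₀ - x₃))`. -/
def upperHalf (x : Mink4) : ℂ × ℝ :=
  (((x 1 : ℂ) + Complex.I * (x 2 : ℂ)) / ((x 0 - x 3 : ℝ) : ℂ), 1 / (x 0 - x 3))

/-- The curve `γ` in `ℍ³` converges along the filter `l` to the ideal point
`z ∈ ∂ℍ³ = ℂ ∪ {∞}`; the limit is taken in the one-point compactification of `ℂ × ℝ`, in
which `∂ℍ³` is the closure of `ℂ × {0}`. -/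
def TendsToIdeal (γ : ℝ → Mink4) (l : Filter ℝ) (z : OnePoint ℂ) : Prop :=
  Filter.Tendsto (fun t => ((upperHalf (γ t) : ℂ × ℝ) : OnePoint (ℂ × ℝ))) l
    (𝓝 (OnePoint.map (fun w : ℂ => ((w, 0) : ℂ × ℝ)) z))

/-- `γ₋ = -μ₁` and `γ₊ = 1 / conj μ₂`, where `1 / 0 = ∞`. Exactly the geodesics with `γ₊ ≠ 0`
and `γ₋ ≠ ∞` have such coordinates. -/
def HasCoordinates (γ : ℝ → Mink4) (μ : ℂ × ℂ) : Prop :=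
  TendsToIdeal γ Filter.atBot ((-μ.1 : ℂ) : OnePoint ℂ) ∧
  TendsToIdeal γ Filter.atTop
    (open Classical in if μ.2 = 0 then OnePoint.infty else (((conj μ.2)⁻¹ : ℂ) : OnePoint ℂ))

/-- The isometry `a` moves the oriented geodesic `ℓ` to the one with coordinates `μ`. -/
def HasCoordinatesAfter (a : SL(2, ℂ)) (ℓ : OrientedGeodesics) (μ : ℂ × ℂ) : Prop :=
  ∃ γ : ℝ → Mink4, Represents γ ℓ ∧ HasCoordinates (fun t => isomAct a (γ t)) μ

/-! ### The invariant metrics -/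

/-- The quadratic form of `𝒢 = 4 dμ₁ dμ̄₂ / (1 + μ₁ μ̄₂)²` on the tangent vector `w` at `μ`. -/
def metricG (μ w : ℂ × ℂ) : ℂ := 4 * w.1 * conj w.2 / (1 + μ.1 * conj μ.2) ^ 2

/-- `𝒢ʳ(w, w)`, the real part of `𝒢(w, w)`. -/
def metricRe (μ w : ℂ × ℂ) : ℝ := (metricG μ w).re

/-- `𝒢ⁱ(w, w)`, the imaginary part of `𝒢(w, w)`. -/
def metricIm (μ w : ℂ × ℂ) : ℝ := (metricG μ w).im

/-- A smooth regular curve `s ↦ (μ₁(s), μ₂(s))`, `s ∈ I`, in the coordinate domain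
`{1 + μ₁ μ̄₂ ≠ 0}` of the space of oriented geodesics that is null for `𝒢ⁱ` and
causal for `𝒢ʳ`. -/
structure IsNullCausalCoord (I : TopologicalSpace.Opens ℝ) (μ : ℝ → ℂ × ℂ) : Prop where
  smooth : ContDiffOn ℝ ∞ μ I
  mem_domain : ∀ s ∈ I, 1 + (μ s).1 * conj (μ s).2 ≠ 0
  regular : ∀ s ∈ I, deriv μ s ≠ 0
  null_im : ∀ s ∈ I, metricIm (μ s) (deriv μ s) = 0
  causal_re : ∀ s ∈ I, metricRe (μ s) (deriv μ s) ≤ 0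

/-- A smooth regular curve `α`, defined on `I`, in the whole space of oriented geodesics that is
null for `𝒢ⁱ` and causal for `𝒢ʳ`. The domains of the coordinates `μ ∘ a`, for `a ∈ SL(2, ℂ)`,
cover the space of oriented geodesics; both metrics are invariant under `SL(2, ℂ)`, so they are
given by the same formulas in all of these coordinates. -/
def IsNullCausal (I : TopologicalSpace.Opens ℝ) (α : ℝ → OrientedGeodesics) : Prop :=
  ∀ s₀ ∈ I, ∃ (a : SL(2, ℂ)) (μ : ℝ → ℂ × ℂ), ContDiffAt ℝ ∞ μ s₀ ∧
    (∀ᶠ s in 𝓝 s₀, HasCoordinatesAfter a (α s) (μ s)) ∧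
    deriv μ s₀ ≠ 0 ∧ metricIm (μ s₀) (deriv μ s₀) = 0 ∧ metricRe (μ s₀) (deriv μ s₀) ≤ 0

/-- The explicit unit speed parametrization of the geodesic with coordinates `μ`. -/
def geodesicOf (μ : ℂ × ℂ) (t : ℝ) : Mink4 :=
  ofHerm (((‖1 + μ.1 * conj μ.2‖⁻¹ : ℝ) : ℂ) •
    !![(Real.exp t : ℂ) + (Real.exp (-t) : ℂ) * (‖μ.1‖ : ℂ) ^ 2,
        (Real.exp t : ℂ) * μ.2 - (Real.exp (-t) : ℂ) * μ.1;
      (Real.exp t : ℂ) * conj μ.2 - (Real.exp (-t) : ℂ) * conj μ.1,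
        (Real.exp t : ℂ) * (‖μ.2‖ : ℂ) ^ 2 + (Real.exp (-t) : ℂ)])

/-! ### Surfaces in hyperbolic space -/

/-- Partial derivative of a parametrized surface in the first parameter. -/
def partialS (F : ℝ × ℝ → Mink4) (x : ℝ × ℝ) : Mink4 := fderiv ℝ F x (1, 0)

/-- Partial derivative of a parametrized surface in the second parameter. -/
def partialT (F : ℝ × ℝ → Mink4) (x : ℝ × ℝ) : Mink4 := fderiv ℝ F x (0, 1)

/-- The cross product `(i/2) (X p⁻¹ Y - Y p⁻¹ X)` of the tangent space at `p ∈ ℍ³`. -/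
def crossAt (p x y : Mink4) : Mink4 :=
  ofHerm ((Complex.I / 2) • (toHerm x * (toHerm p)⁻¹ * toHerm y -
    toHerm y * (toHerm p)⁻¹ * toHerm x))

/-- The unit normal field `F_s × F_t / |F_s × F_t|` of a parametrized surface. -/
def unitNormal (F : ℝ × ℝ → Mink4) (x : ℝ × ℝ) : Mink4 :=
  (Real.sqrt (lorentz (crossAt (F x) (partialS F x) (partialT F x))
    (crossAt (F x) (partialS F x) (partialT F x))))⁻¹ •
      crossAt (F x) (partialS F x) (partialT F x)

/-- The extrinsic curvature (product of the principal curvatures, that is, determinant of the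
second over determinant of the first fundamental form) of a parametrized surface. -/
def extCurvaturePatch (F : ℝ × ℝ → Mink4) (x : ℝ × ℝ) : ℝ :=
  (lorentz (partialS F x) (partialS (unitNormal F) x)
      * lorentz (partialT F x) (partialT (unitNormal F) x)
    - lorentz (partialS F x) (partialT (unitNormal F) x)
      * lorentz (partialT F x) (partialS (unitNormal F) x))
  / (lorentz (partialS F x) (partialS F x) * lorentz (partialT F x) (partialT F x)
      - lorentz (partialS F x) (partialT F x) ^ 2)

section Surfaces

variable {S : Type*} [TopologicalSpace S] [ChartedSpace (ℝ × ℝ) S]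

/-- A surface in `ℍ³`: a smooth immersion of the `2`-manifold `S` into `ℍ³`. -/
structure IsSurface (f : S → Mink4) : Prop where
  smooth : ContMDiff 𝓘(ℝ, ℝ × ℝ) 𝓘(ℝ, Mink4) ∞ f
  mem_hyp : ∀ p, f p ∈ Hyp3
  immersion : ∀ p, Function.Injective (mfderiv 𝓘(ℝ, ℝ × ℝ) 𝓘(ℝ, Mink4) f p)

/-- The extrinsic curvature at `p`, computed in the preferred chart at `p` (for a surface the
value is the same in every smooth chart). -/
def extCurvature (f : S → Mink4) (p : S) : ℝ :=
  extCurvaturePatch (f ∘ (chartAt (ℝ × ℝ) p).symm) (chartAt (ℝ × ℝ) p p)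

/-- In the chart `φ = (s, t)` the map `f` is `c(s) cosh t + v(s) sinh t`, where `c` is a smooth
curve in `ℍ³` and `v` is a smooth unit normal vector field along `c`. -/
structure IsRuledPatch (f : S → Mink4) (φ : OpenPartialHomeomorph S (ℝ × ℝ))
    (c v : ℝ → Mink4) : Prop where
  chart : φ ∈ IsManifold.maximalAtlas 𝓘(ℝ, ℝ × ℝ) ∞ S
  smooth_base : ContDiffOn ℝ ∞ c (Prod.fst '' φ.target)
  smooth_dir : ContDiffOn ℝ ∞ v (Prod.fst '' φ.target)
  unit : ∀ s ∈ Prod.fst '' φ.target, (c s, v s) ∈ UnitTangent3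
  normal : ∀ s ∈ Prod.fst '' φ.target, lorentz (deriv c s) (v s) = 0
  eq : ∀ x ∈ φ.target, f (φ.symm x) = geodesicCurve (c x.1) (v x.1) x.2

/-- Ruled surfaces: every point has a coordinate neighbourhood ruled by geodesic arcs. -/
def IsRuled (f : S → Mink4) : Prop :=
  ∀ p, ∃ φ c v, p ∈ φ.source ∧ IsRuledPatch f φ c v

/-- Surfaces ruled by complete geodesics: every point has a ruled coordinate neighbourhood
with coordinates `(s, t)` ranging in `J × ℝ`, `J` an open interval. -/
def IsRuledByCompleteGeodesics (f : S → Mink4) : Prop :=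
  ∀ p, ∃ φ c v, p ∈ φ.source ∧ IsRuledPatch f φ c v ∧
    ∃ J : Set ℝ, IsOpen J ∧ J.OrdConnected ∧ φ.target = J ×ˢ Set.univ

/-- Developable surfaces: extrinsically flat ruled surfaces. -/
structure IsDevelopable (f : S → Mink4) : Prop where
  surface : IsSurface f
  ruled : IsRuled f
  flat : ∀ p, extCurvature f p = 0

end Surfaces

/-- The open set `I × ℝ` of the plane, as a `2`-manifold. -/
def strip (I : TopologicalSpace.Opens ℝ) : TopologicalSpace.Opens (ℝ × ℝ) :=
  ⟨{x | x.1 ∈ I}, I.isOpen.preimage continuous_fst⟩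

end

/-!
A geodesic `c cosh t + v sinh t` of `ℍ³` is determined by the null vectors `c + v` and `c - v`,
which span its endpoints. It has coordinates `μ` exactly when these are positive multiples of
`ξ ξ* = rayPlus μ₂` and `η η* = rayMinus μ₁`, where `ξ = (1, μ̄₂)` and `η = (-μ₁, 1)`, and it is
then `geodesicOf μ` up to a shift of `t` (`hasCoordinates_iff`, `geodesicCurve_eq_geodesicOf`).

For a smooth family of geodesics everything is decided by the jet `(c, v, c', v')`. The surface
is extrinsically flat along a geodesic when `det (c, v, c', v') = 0`, because the second
fundamental form has no `dt²` part (`IsPatch.ruled_extCurvature_iff`), and it is immersed there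
when `c' cosh t + v' sinh t` never lies in the plane of `c` and `v` (`ruled_immersion_iff`). In
coordinates, with `D = 1 + μ₁ μ̄₂`, the determinant is a positive multiple of
`Im (μ₁' μ̄₂' D̄²)`, that is, of `𝒢ⁱ`, and the normal part of `c' cosh t + v' sinh t` is
`x eᵗ μ̄₂' D̄ - y e⁻ᵗ μ̄₁' D` up to a factor, with `x, y > 0`. Given `𝒢ⁱ = 0`,
the latter vanishes for some `t` exactly when `𝒢ʳ > 0` or `μ' = 0`. Hence flat and immersed
means null-causal (`isFlatJet_and_isImmersedJet_iff`, `jets_iff_nullCausal`).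

What remains is bookkeeping. Flatness does not depend on the chart
(`IsPatch.extCurvaturePatch_comp`); a shift of `t` by a primitive of `⟨c', v⟩` makes the base
curve orthogonal to the rulings (`isDevelopable_of_jets`); the representatives whose parameter is
measured from the point closest to `(1, 0, 0, 0)` depend smoothly on the oriented geodesic
(`IsNullCausal.exists_smooth_representative`); and every geodesic can be moved into the
coordinate domain by an isometry (`exists_isom_into_domain`), which gives the converse
(`IsDevelopable.exists_nullCausal`).
-/

/-! ### Lorentz algebra -/

theorem lorentz_comm (x y : Mink4) : lorentz x y = lorentz y x := by
  simp only [lorentz]; ring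

theorem lorentz_add_left (x y z : Mink4) : lorentz (x + y) z = lorentz x z + lorentz y z := by
  simp only [lorentz, Pi.add_apply]; ring

theorem lorentz_sub_left (x y z : Mink4) : lorentz (x - y) z = lorentz x z - lorentz y z := by
  simp only [lorentz, Pi.sub_apply]; ring

theorem lorentz_smul_left (k : ℝ) (x z : Mink4) : lorentz (k • x) z = k * lorentz x z := by
  simp only [lorentz, Pi.smul_apply, smul_eq_mul]; ring

theorem lorentz_add_right (x y z : Mink4) : lorentz z (x + y) = lorentz z x + lorentz z y := by
  simp only [lorentz, Pi.add_apply]; ring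

theorem lorentz_sub_right (x y z : Mink4) : lorentz z (x - y) = lorentz z x - lorentz z y := by
  simp only [lorentz, Pi.sub_apply]; ring

theorem lorentz_smul_right (k : ℝ) (x z : Mink4) : lorentz z (k • x) = k * lorentz z x := by
  simp only [lorentz, Pi.smul_apply, smul_eq_mul]; ring

theorem lorentz_zero_left (x : Mink4) : lorentz 0 x = 0 := by simp [lorentz]

/-- The Lorentz metric is positive definite on the orthogonal complement of a point of `ℍ³`. -/
theorem lorentz_self_pos {p x : Mink4} (hp : lorentz p p = -1) (h : lorentz p x = 0)
    (hx : x ≠ 0) : 0 < lorentz x x := by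
  simp only [lorentz] at hp h ⊢
  have hp0 : 0 < p 0 ^ 2 := by nlinarith [sq_nonneg (p 1), sq_nonneg (p 2), sq_nonneg (p 3)]
  -- Lagrange's identity for the spatial parts, with `p₀ x₀` in place of their scalar product
  have key : p 0 ^ 2 * (-(x 0 * x 0) + x 1 * x 1 + x 2 * x 2 + x 3 * x 3)
      = x 1 ^ 2 + x 2 ^ 2 + x 3 ^ 2 + (p 1 * x 2 - p 2 * x 1) ^ 2 + (p 1 * x 3 - p 3 * x 1) ^ 2
        + (p 2 * x 3 - p 3 * x 2) ^ 2 := by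
    have h' : p 0 * x 0 = p 1 * x 1 + p 2 * x 2 + p 3 * x 3 := by linarith
    have hp' : p 0 ^ 2 = 1 + p 1 ^ 2 + p 2 ^ 2 + p 3 ^ 2 := by linarith
    have : p 0 ^ 2 * (x 0 * x 0) = (p 1 * x 1 + p 2 * x 2 + p 3 * x 3) ^ 2 := by
      rw [← h']; ring
    linear_combination -this + (x 1 * x 1 + x 2 * x 2 + x 3 * x 3) * hp'
  by_contra hneg
  have h1 : p 0 ^ 2 * (-(x 0 * x 0) + x 1 * x 1 + x 2 * x 2 + x 3 * x 3) ≤ 0 :=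
    mul_nonpos_of_nonneg_of_nonpos hp0.le (not_lt.mp hneg)
  have a1 : x 1 = 0 := by
    have : x 1 ^ 2 ≤ 0 := by
      nlinarith [sq_nonneg (x 2), sq_nonneg (x 3), sq_nonneg (p 1 * x 2 - p 2 * x 1),
        sq_nonneg (p 1 * x 3 - p 3 * x 1), sq_nonneg (p 2 * x 3 - p 3 * x 2)]
    exact pow_eq_zero_iff two_ne_zero |>.1 (le_antisymm this (sq_nonneg _))
  have a2 : x 2 = 0 := by
    have : x 2 ^ 2 ≤ 0 := by
      nlinarith [sq_nonneg (x 1), sq_nonneg (x 3), sq_nonneg (p 1 * x 2 - p 2 * x 1),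
        sq_nonneg (p 1 * x 3 - p 3 * x 1), sq_nonneg (p 2 * x 3 - p 3 * x 2)]
    exact pow_eq_zero_iff two_ne_zero |>.1 (le_antisymm this (sq_nonneg _))
  have a3 : x 3 = 0 := by
    have : x 3 ^ 2 ≤ 0 := by
      nlinarith [sq_nonneg (x 2), sq_nonneg (x 1), sq_nonneg (p 1 * x 2 - p 2 * x 1),
        sq_nonneg (p 1 * x 3 - p 3 * x 1), sq_nonneg (p 2 * x 3 - p 3 * x 2)]
    exact pow_eq_zero_iff two_ne_zero |>.1 (le_antisymm this (sq_nonneg _))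
  have a0 : x 0 = 0 := by
    rw [a1, a2, a3] at h
    have : p 0 * x 0 = 0 := by linarith
    rcases mul_eq_zero.1 this with h0 | h0
    · rw [h0] at hp0; norm_num at hp0
    · exact h0
  exact hx (by ext i; fin_cases i <;> assumption)

/-- Determinant of three columns of the matrix with rows `p, x, y`. -/
def minor3 (i j k : Fin 4) (p x y : Mink4) : ℝ :=
  p i * (x j * y k - x k * y j) - p j * (x i * y k - x k * y i) + p k * (x i * y j - x j * y i)

/-- The triple product of Lorentz-Minkowski space: `⟨tripleProd p x y, z⟩ = det (p, x, y, z)`. -/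
def tripleProd (p x y : Mink4) : Mink4 :=
  ![minor3 1 2 3 p x y, minor3 0 2 3 p x y, -minor3 0 1 3 p x y, minor3 0 1 2 p x y]

/-- The determinant of four vectors of Lorentz-Minkowski space. -/
def det4 (p x y z : Mink4) : ℝ := lorentz (tripleProd p x y) z

theorem det4_eq_det (p x y z : Mink4) :
    det4 p x y z = (Matrix.of ![p, x, y, z]).det := by
  simp [det4, lorentz, tripleProd, minor3, Matrix.det_succ_row_zero, Fin.sum_univ_succ,
    Fin.succAbove, Matrix.submatrix]
  ring

/-- The cross product of a tangent space of `ℍ³` is the triple product with the base point. -/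
theorem crossAt_eq_tripleProd {p : Mink4} (hp : lorentz p p = -1) (x y : Mink4) :
    crossAt p x y = tripleProd p x y := by
  have hinv : (toHerm p)⁻¹ = toHerm ![p 0, -p 1, -p 2, -p 3] := by
    apply Matrix.inv_eq_right_inv
    have hp' : ((p 0 : ℝ) : ℂ) ^ 2 = 1 + (p 1 : ℂ) ^ 2 + (p 2 : ℂ) ^ 2 + (p 3 : ℂ) ^ 2 := by
      simp only [lorentz] at hp
      have : p 0 ^ 2 = 1 + p 1 ^ 2 + p 2 ^ 2 + p 3 ^ 2 := by linarith
      exact_mod_cast this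
    ext i j
    fin_cases i <;> fin_cases j <;> simp [toHerm, Matrix.mul_apply, Fin.sum_univ_two] <;>
      ring_nf <;> simp only [Complex.I_sq, hp'] <;> ring
  rw [crossAt, hinv]
  ext i
  fin_cases i <;>
    simp [ofHerm, toHerm, tripleProd, minor3] <;> ring

theorem tripleProd_smul_comb (p x y : Mink4) (a b c d : ℝ) :
    tripleProd p (a • x + b • y) (c • x + d • y) = (a * d - b * c) • tripleProd p x y := by
  ext i
  fin_cases i <;> simp [tripleProd, minor3] <;> ring

theorem lorentz_tripleProd_self_left (p x y : Mink4) : lorentz (tripleProd p x y) p = 0 := by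
  simp [lorentz, tripleProd, minor3]; ring

theorem lorentz_tripleProd_self_mid (p x y : Mink4) : lorentz (tripleProd p x y) x = 0 := by
  simp [lorentz, tripleProd, minor3]; ring

theorem lorentz_tripleProd_self_right (p x y : Mink4) : lorentz (tripleProd p x y) y = 0 := by
  simp [lorentz, tripleProd, minor3]; ring

/-- The square of the triple product is minus a Gram determinant. -/
theorem lorentz_tripleProd_tripleProd (p x y : Mink4) :
    lorentz (tripleProd p x y) (tripleProd p x y) =
      -(lorentz p p * (lorentz x x * lorentz y y - lorentz x y ^ 2)
        - lorentz p x * (lorentz p x * lorentz y y - lorentz x y * lorentz p y)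
        + lorentz p y * (lorentz p x * lorentz x y - lorentz x x * lorentz p y)) := by
  simp [lorentz, tripleProd, minor3]; ring

theorem det4_comb (c v c' v' : Mink4) (a b d e : ℝ) :
    det4 (a • c + b • v) (a • c' + b • v') (d • c + e • v) (d • c' + e • v') =
      -(a * e - b * d) ^ 2 * det4 c v c' v' := by
  simp [det4, lorentz, tripleProd, minor3]; ring

/-! ### The action of `SL(2, ℂ)` -/

theorem toHerm_isHermitian (x : Mink4) : (toHerm x).IsHermitian := by
  ext i j
  fin_cases i <;> fin_cases j <;> simp [toHerm, Matrix.conjTranspose_apply, Complex.ext_iff]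

theorem toHerm_ofHerm {X : Matrix (Fin 2) (Fin 2) ℂ} (hX : X.IsHermitian) :
    toHerm (ofHerm X) = X := by
  have h := fun i j => congrFun (congrFun hX i) j
  have h00 := h 0 0
  have h10 := h 1 0
  have h11 := h 1 1
  simp only [Matrix.conjTranspose_apply, Complex.star_def, Complex.ext_iff, Complex.conj_re,
    Complex.conj_im] at h00 h10 h11
  ext i j
  fin_cases i <;> fin_cases j <;> simp [toHerm, ofHerm, Complex.ext_iff]
  · constructor
    · ring
    · linarith
  · exact ⟨h10.1, h10.2⟩
  · constructor
    · ring
    · linarith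

theorem ofHerm_toHerm (x : Mink4) : ofHerm (toHerm x) = x := by
  ext i
  fin_cases i <;> simp [toHerm, ofHerm]

theorem toHerm_isomAct (a : SL(2, ℂ)) (x : Mink4) :
    toHerm (isomAct a x) = (a : Matrix (Fin 2) (Fin 2) ℂ) * toHerm x *
      (a : Matrix (Fin 2) (Fin 2) ℂ).conjTranspose :=
  toHerm_ofHerm (Matrix.isHermitian_mul_mul_conjTranspose _ (toHerm_isHermitian x))

theorem isomAct_mul (a b : SL(2, ℂ)) (x : Mink4) :
    isomAct (a * b) x = isomAct a (isomAct b x) := by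
  conv_rhs => rw [isomAct, toHerm_isomAct]
  rw [isomAct]
  simp [Matrix.mul_assoc, Matrix.conjTranspose_mul]

theorem isomAct_one (x : Mink4) : isomAct 1 x = x := by
  simp [isomAct, ofHerm_toHerm]

theorem isomAct_inv_isomAct (a : SL(2, ℂ)) (x : Mink4) : isomAct a⁻¹ (isomAct a x) = x := by
  rw [← isomAct_mul, inv_mul_cancel, isomAct_one]

theorem isomAct_isomAct_inv (a : SL(2, ℂ)) (x : Mink4) : isomAct a (isomAct a⁻¹ x) = x := by
  rw [← isomAct_mul, mul_inv_cancel, isomAct_one]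

theorem isomAct_add (a : SL(2, ℂ)) (x y : Mink4) :
    isomAct a (x + y) = isomAct a x + isomAct a y := by
  have : toHerm (x + y) = toHerm x + toHerm y := by
    ext i j
    fin_cases i <;> fin_cases j <;> simp [toHerm] <;> ring
  have h2 : ∀ X Y, ofHerm (X + Y) = ofHerm X + ofHerm Y := by
    intro X Y
    ext i
    fin_cases i <;> simp [ofHerm] <;> ring
  rw [isomAct, this, mul_add, add_mul, h2]; rfl

theorem isomAct_smul (a : SL(2, ℂ)) (k : ℝ) (x : Mink4) :
    isomAct a (k • x) = k • isomAct a x := by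
  have : toHerm (k • x) = (k : ℂ) • toHerm x := by
    ext i j
    fin_cases i <;> fin_cases j <;> simp [toHerm] <;> ring
  have h2 : ∀ X, ofHerm ((k : ℂ) • X) = k • ofHerm X := by
    intro X
    ext i
    fin_cases i <;> simp [ofHerm] <;> ring
  rw [isomAct, this, Matrix.mul_smul, Matrix.smul_mul, h2]; rfl

/-- The action of an element of `SL(2, ℂ)` as a continuous linear map. -/
noncomputable def isomCLM (a : SL(2, ℂ)) : Mink4 →L[ℝ] Mink4 :=
  LinearMap.toContinuousLinearMap
    { toFun := isomAct a, map_add' := isomAct_add a, map_smul' := isomAct_smul a }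

theorem isomCLM_apply (a : SL(2, ℂ)) (x : Mink4) : isomCLM a x = isomAct a x := rfl

theorem isomAct_sub (a : SL(2, ℂ)) (x y : Mink4) :
    isomAct a (x - y) = isomAct a x - isomAct a y := (isomCLM a).map_sub x y

theorem isomAct_injective (a : SL(2, ℂ)) : Function.Injective (isomAct a) :=
  Function.LeftInverse.injective (isomAct_inv_isomAct a)

theorem det_toHerm (x : Mink4) : (toHerm x).det = ((-lorentz x x : ℝ) : ℂ) := by
  rw [Matrix.det_fin_two]
  simp [toHerm, lorentz]
  ring_nf
  simp only [Complex.I_sq]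
  ring

theorem lorentz_isomAct (a : SL(2, ℂ)) (x y : Mink4) :
    lorentz (isomAct a x) (isomAct a y) = lorentz x y := by
  have hq : ∀ z, lorentz (isomAct a z) (isomAct a z) = lorentz z z := by
    intro z
    have h := det_toHerm (isomAct a z)
    rw [toHerm_isomAct, Matrix.det_mul, Matrix.det_mul, Matrix.det_conjTranspose, a.2,
      det_toHerm] at h
    simp only [one_mul, star_one, mul_one, Complex.ofReal_inj] at h
    linarith
  have h := hq (x + y)
  rw [isomAct_add] at h
  simp only [lorentz_add_left, lorentz_add_right, hq] at h
  linarith [lorentz_comm (isomAct a x) (isomAct a y), lorentz_comm x y]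

theorem mem_Hyp3_isomAct (a : SL(2, ℂ)) {x : Mink4} (hx : x ∈ Hyp3) : isomAct a x ∈ Hyp3 := by
  refine ⟨(lorentz_isomAct a x x).trans hx.1, ?_⟩
  obtain ⟨h1, h0⟩ := hx
  simp only [lorentz] at h1
  have hu : 0 < x 0 - x 3 := by nlinarith [sq_nonneg (x 1), sq_nonneg (x 2)]
  have hv : 0 < x 0 + x 3 := by nlinarith [sq_nonneg (x 1), sq_nonneg (x 2)]
  -- a positive definite Hermitian form is positive on the rows of `a`
  have key : ∀ a1 a2 b1 b2 : ℝ, (a1 ≠ 0 ∨ a2 ≠ 0 ∨ b1 ≠ 0 ∨ b2 ≠ 0) →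
      0 < (x 0 + x 3) * (a1 ^ 2 + a2 ^ 2) + (x 0 - x 3) * (b1 ^ 2 + b2 ^ 2)
        + 2 * (x 1 * (a1 * b1 + a2 * b2) - x 2 * (a2 * b1 - a1 * b2)) := by
    intro a1 a2 b1 b2 hne
    have e : (x 0 + x 3) * ((x 0 + x 3) * (a1 ^ 2 + a2 ^ 2) + (x 0 - x 3) * (b1 ^ 2 + b2 ^ 2)
        + 2 * (x 1 * (a1 * b1 + a2 * b2) - x 2 * (a2 * b1 - a1 * b2)))
        = ((x 0 + x 3) * a1 + x 1 * b1 + x 2 * b2) ^ 2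
          + ((x 0 + x 3) * a2 + x 1 * b2 - x 2 * b1) ^ 2 + (b1 ^ 2 + b2 ^ 2) := by
      linear_combination (-b1 ^ 2 - b2 ^ 2) * h1
    by_contra hcon
    have hle := mul_nonpos_of_nonneg_of_nonpos hv.le (not_lt.mp hcon)
    rw [e] at hle
    have hb1 : b1 = 0 := by
      refine pow_eq_zero_iff two_ne_zero |>.1 (le_antisymm ?_ (sq_nonneg _))
      linarith [sq_nonneg ((x 0 + x 3) * a1 + x 1 * b1 + x 2 * b2),
        sq_nonneg ((x 0 + x 3) * a2 + x 1 * b2 - x 2 * b1), sq_nonneg b2]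
    have hb2 : b2 = 0 := by
      refine pow_eq_zero_iff two_ne_zero |>.1 (le_antisymm ?_ (sq_nonneg _))
      linarith [sq_nonneg ((x 0 + x 3) * a1 + x 1 * b1 + x 2 * b2),
        sq_nonneg ((x 0 + x 3) * a2 + x 1 * b2 - x 2 * b1), sq_nonneg b1]
    subst hb1 hb2
    have ha1 : a1 = 0 := by
      by_contra ha
      have := mul_pos hv hv
      have := sq_pos_of_ne_zero ha
      nlinarith [sq_nonneg a2]
    have ha2 : a2 = 0 := by
      by_contra ha
      have := mul_pos hv hv
      have := sq_pos_of_ne_zero ha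
      nlinarith [sq_nonneg a1]
    simp [ha1, ha2] at hne
  have hrow : ∀ i, ((a : Matrix (Fin 2) (Fin 2) ℂ) i 0).re ≠ 0 ∨
      ((a : Matrix (Fin 2) (Fin 2) ℂ) i 0).im ≠ 0 ∨
      ((a : Matrix (Fin 2) (Fin 2) ℂ) i 1).re ≠ 0 ∨
      ((a : Matrix (Fin 2) (Fin 2) ℂ) i 1).im ≠ 0 := by
    intro i
    by_contra hcon
    push Not at hcon
    have h0' : (a : Matrix (Fin 2) (Fin 2) ℂ) i 0 = 0 := Complex.ext hcon.1 hcon.2.1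
    have h1' : (a : Matrix (Fin 2) (Fin 2) ℂ) i 1 = 0 := Complex.ext hcon.2.2.1 hcon.2.2.2
    have hd := a.2
    rw [Matrix.det_fin_two] at hd
    fin_cases i <;> simp_all
  have k0 := key _ _ _ _ (hrow 0)
  have k1 := key _ _ _ _ (hrow 1)
  simp [isomAct, ofHerm, toHerm, Matrix.mul_apply, Fin.sum_univ_two, Matrix.conjTranspose_apply]
  nlinarith [k0, k1]

theorem mem_UnitTangent3_isomAct (a : SL(2, ℂ)) {c v : Mink4} (h : (c, v) ∈ UnitTangent3) :
    (isomAct a c, isomAct a v) ∈ UnitTangent3 :=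
  ⟨mem_Hyp3_isomAct a h.1, (lorentz_isomAct a v v).trans h.2.1, (lorentz_isomAct a c v).trans h.2.2⟩

theorem isomAct_geodesicCurve (a : SL(2, ℂ)) (c v : Mink4) (t : ℝ) :
    isomAct a (geodesicCurve c v t) = geodesicCurve (isomAct a c) (isomAct a v) t := by
  simp only [geodesicCurve, isomAct_add, isomAct_smul]

theorem det4_isomAct_eq_zero_iff (a : SL(2, ℂ)) (c v c' v' : Mink4) :
    det4 (isomAct a c) (isomAct a v) (isomAct a c') (isomAct a v') = 0 ↔ det4 c v c' v' = 0 := by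
  have key : ∀ (b : SL(2, ℂ)) (x y z w : Mink4),
      det4 (isomAct b x) (isomAct b y) (isomAct b z) (isomAct b w) =
        (LinearMap.toMatrix' (isomCLM b : Mink4 →ₗ[ℝ] Mink4)).det * det4 x y z w := by
    intro b x y z w
    rw [det4_eq_det, det4_eq_det, mul_comm, ← Matrix.det_transpose (LinearMap.toMatrix' _),
      ← Matrix.det_mul]
    congr 1
    ext i j
    have h : ∀ x, isomAct b x j = ∑ k, x k * isomCLM b (Pi.single k 1) j := by
      intro x
      have h := congrFun (LinearMap.toMatrix'_mulVec (isomCLM b : Mink4 →ₗ[ℝ] Mink4) x) j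
      simp only [Matrix.mulVec, dotProduct, LinearMap.toMatrix'_apply] at h
      rw [← isomCLM_apply]
      refine h.symm.trans (Finset.sum_congr rfl fun k _ => ?_)
      rw [mul_comm]; rfl
    fin_cases i <;> simp only [Matrix.mul_apply, Matrix.transpose_apply] <;>
      simp <;> exact h _
  constructor
  · intro h
    have := key a⁻¹ (isomAct a c) (isomAct a v) (isomAct a c') (isomAct a v')
    rwa [h, mul_zero, isomAct_inv_isomAct, isomAct_inv_isomAct, isomAct_inv_isomAct,
      isomAct_inv_isomAct] at this
  · intro h
    rw [key, h, mul_zero]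

/-! ### Null rays and ideal endpoints -/

/-- The null vector `(1, z; z̄, |z|²)`, which spans the ideal point with second coordinate
`μ₂ = z`. -/
noncomputable def rayPlus (z : ℂ) : Mink4 :=
  ![(1 + (z.re ^ 2 + z.im ^ 2)) / 2, z.re, z.im, (1 - (z.re ^ 2 + z.im ^ 2)) / 2]

/-- The null vector `(|z|², -z; -z̄, 1)`, which spans the ideal point with first coordinate
`μ₁ = z`. -/
noncomputable def rayMinus (z : ℂ) : Mink4 :=
  ![(1 + (z.re ^ 2 + z.im ^ 2)) / 2, -z.re, -z.im, ((z.re ^ 2 + z.im ^ 2) - 1) / 2]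

theorem lorentz_rayPlus_self (z : ℂ) : lorentz (rayPlus z) (rayPlus z) = 0 := by
  simp [lorentz, rayPlus]; ring

theorem lorentz_rayMinus_self (z : ℂ) : lorentz (rayMinus z) (rayMinus z) = 0 := by
  simp [lorentz, rayMinus]; ring

theorem lorentz_rayPlus_rayMinus (μ : ℂ × ℂ) :
    lorentz (rayPlus μ.2) (rayMinus μ.1) = -‖1 + μ.1 * conj μ.2‖ ^ 2 / 2 := by
  rw [← Complex.normSq_eq_norm_sq]
  simp [lorentz, rayPlus, rayMinus, Complex.normSq_apply]; ring

theorem geodesicOf_eq (μ : ℂ × ℂ) (t : ℝ) :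
    geodesicOf μ t = ‖1 + μ.1 * conj μ.2‖⁻¹ •
      (Real.exp t • rayPlus μ.2 + Real.exp (-t) • rayMinus μ.1) := by
  have h : ∀ z : ℂ, ((‖z‖ : ℂ)) ^ 2 = ((z.re ^ 2 + z.im ^ 2 : ℝ) : ℂ) := by
    intro z
    rw [← Complex.ofReal_pow, ← Complex.normSq_eq_norm_sq, Complex.normSq_apply]
    congr 1; ring
  unfold geodesicOf
  rw [h, h]
  generalize ‖1 + μ.1 * conj μ.2‖⁻¹ = k
  generalize Real.exp t = a
  generalize Real.exp (-t) = b
  ext i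
  fin_cases i <;> simp [ofHerm, rayPlus, rayMinus, -Complex.ofReal_pow] <;>
    first | ring1 | (left; ring1)

theorem geodesicCurve_eq (c v : Mink4) (t : ℝ) :
    geodesicCurve c v t =
      (Real.exp t / 2) • (c + v) + (Real.exp (-t) / 2) • (c - v) := by
  rw [geodesicCurve, Real.cosh_eq, Real.sinh_eq]
  ext i
  simp; ring

section Ends

variable {c v : Mink4}

theorem mem_UnitTangent3_neg (h : (c, v) ∈ UnitTangent3) : (c, -v) ∈ UnitTangent3 := by
  obtain ⟨h1, h2, h3⟩ := h
  refine ⟨h1, ?_, ?_⟩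
  · simp only [lorentz, Pi.neg_apply] at h2 ⊢; linarith
  · simp only [lorentz, Pi.neg_apply] at h3 ⊢; linarith

theorem lorentz_end_self (h : (c, v) ∈ UnitTangent3) : lorentz (c + v) (c + v) = 0 := by
  obtain ⟨⟨h1, -⟩, h2, h3⟩ := h
  simp only [lorentz_add_left, lorentz_add_right, lorentz_comm v c] at *
  linarith

theorem lorentz_ends (h : (c, v) ∈ UnitTangent3) : lorentz (c + v) (c - v) = -2 := by
  obtain ⟨⟨h1, -⟩, h2, h3⟩ := h
  simp only [lorentz_add_left, lorentz_sub_right, lorentz_comm v c] at *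
  linarith

theorem end_time_pos (h : (c, v) ∈ UnitTangent3) : 0 < (c + v) 0 := by
  obtain ⟨⟨h1, h0⟩, h2, h3⟩ := h
  simp only [lorentz, Pi.add_apply] at *
  by_contra hcon
  -- the Cauchy-Schwarz inequality for the spatial parts
  have cs : (c 1 * v 1 + c 2 * v 2 + c 3 * v 3) ^ 2 ≤
      (c 1 ^ 2 + c 2 ^ 2 + c 3 ^ 2) * (v 1 ^ 2 + v 2 ^ 2 + v 3 ^ 2) := by
    nlinarith [sq_nonneg (c 1 * v 2 - c 2 * v 1), sq_nonneg (c 1 * v 3 - c 3 * v 1),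
      sq_nonneg (c 2 * v 3 - c 3 * v 2)]
  have e1 : c 1 * v 1 + c 2 * v 2 + c 3 * v 3 = c 0 * v 0 := by linarith
  have e2 : c 1 ^ 2 + c 2 ^ 2 + c 3 ^ 2 = c 0 ^ 2 - 1 := by linarith
  have e3 : v 1 ^ 2 + v 2 ^ 2 + v 3 ^ 2 = v 0 ^ 2 + 1 := by linarith
  rw [e1, e2, e3] at cs
  nlinarith

theorem start_time_pos (h : (c, v) ∈ UnitTangent3) : 0 < (c - v) 0 := by
  rw [sub_eq_add_neg]; exact end_time_pos (mem_UnitTangent3_neg h)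

theorem lorentz_start_self (h : (c, v) ∈ UnitTangent3) : lorentz (c - v) (c - v) = 0 := by
  rw [sub_eq_add_neg]; exact lorentz_end_self (mem_UnitTangent3_neg h)

theorem geodesicCurve_mem_Hyp3 (h : (c, v) ∈ UnitTangent3) (t : ℝ) :
    geodesicCurve c v t ∈ Hyp3 := by
  constructor
  · obtain ⟨⟨h1, -⟩, h2, h3⟩ := h
    simp only [geodesicCurve, lorentz_add_left, lorentz_add_right, lorentz_smul_left,
      lorentz_smul_right, lorentz_comm v c] at *
    rw [h1, h2, h3]
    linear_combination -Real.cosh_sq t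
  · rw [geodesicCurve_eq]
    have h1 := end_time_pos h
    have h2 := start_time_pos h
    simp only [Pi.add_apply, Pi.smul_apply, smul_eq_mul] at h1 h2 ⊢
    positivity

end Ends

/-- The ideal point spanned by a future-directed null vector. -/
noncomputable def idealPoint (N : Mink4) : OnePoint ℂ :=
  open Classical in if N 0 - N 3 = 0 then OnePoint.infty
  else (((N 1 : ℂ) + Complex.I * (N 2 : ℂ)) / ((N 0 - N 3 : ℝ) : ℂ) : ℂ)

theorem Hyp3.sub_pos {x : Mink4} (hx : x ∈ Hyp3) : 0 < x 0 - x 3 := by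
  obtain ⟨h1, h0⟩ := hx
  simp only [lorentz] at h1
  nlinarith [sq_nonneg (x 1), sq_nonneg (x 2)]

/-- In the upper half-space model the geodesic tends to the ideal point spanned by `c + v`. -/
theorem tendsToIdeal_atTop {c v : Mink4} (h : (c, v) ∈ UnitTangent3) :
    TendsToIdeal (geodesicCurve c v) Filter.atTop (idealPoint (c + v)) := by
  have hexp : Filter.Tendsto (fun t : ℝ => Real.exp (-t)) Filter.atTop (𝓝 0) :=
    Real.tendsto_exp_neg_atTop_nhds_zero
  have hpos : ∀ t, 0 < Real.exp t * ((c + v) 0 - (c + v) 3)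
      + Real.exp (-t) * ((c - v) 0 - (c - v) 3) := by
    intro t
    have := Hyp3.sub_pos (geodesicCurve_mem_Hyp3 h t)
    rw [geodesicCurve_eq] at this
    simp only [Pi.add_apply, Pi.sub_apply, Pi.smul_apply, smul_eq_mul] at this ⊢
    linarith
  generalize hP : c + v = P at *
  generalize hM : c - v = M at *
  have hcurve : ∀ t, geodesicCurve c v t = (Real.exp t / 2) • P + (Real.exp (-t) / 2) • M := by
    intro t; rw [← hP, ← hM]; exact geodesicCurve_eq c v t
  unfold TendsToIdeal idealPoint
  split_ifs with h0
  · rw [OnePoint.map_infty]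
    refine OnePoint.tendsto_coe_infty.comp ?_
    rw [Filter.coclosedCompact_eq_cocompact, ← Metric.cobounded_eq_cocompact,
      ← tendsto_norm_atTop_iff_cobounded]
    have hM' : 0 < M 0 - M 3 := by simpa [h0] using hpos 0
    have hlim : Filter.Tendsto (fun t : ℝ => (2 / (M 0 - M 3)) * Real.exp t)
        Filter.atTop Filter.atTop :=
      Real.tendsto_exp_atTop.const_mul_atTop (by positivity)
    refine Filter.tendsto_atTop_mono (fun t => ?_) hlim
    refine le_trans (le_of_eq ?_) (norm_snd_le _)
    have : geodesicCurve c v t 0 - geodesicCurve c v t 3 = Real.exp (-t) * (M 0 - M 3) / 2 := by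
      rw [hcurve]
      simp only [Pi.add_apply, Pi.smul_apply, smul_eq_mul]
      linear_combination (Real.exp t / 2) * h0
    simp only [upperHalf]
    rw [this, Real.norm_of_nonneg (by positivity), Real.exp_neg]
    field_simp
  · rw [OnePoint.map_some]
    refine (OnePoint.continuous_coe.tendsto _).comp ?_
    have hexp2 : Filter.Tendsto (fun t : ℝ => Real.exp (-t) * Real.exp (-t)) Filter.atTop
        (𝓝 0) := by
      simpa using hexp.mul hexp
    have hden : Filter.Tendsto (fun t : ℝ => (P 0 - P 3) +
        Real.exp (-t) * Real.exp (-t) * (M 0 - M 3)) Filter.atTop (𝓝 (P 0 - P 3)) := by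
      simpa using (hexp2.mul_const (M 0 - M 3)).const_add (P 0 - P 3)
    have hu : ∀ t, geodesicCurve c v t 0 - geodesicCurve c v t 3 =
        Real.exp t / 2 * ((P 0 - P 3) + Real.exp (-t) * Real.exp (-t) * (M 0 - M 3)) := by
      intro t
      rw [hcurve]
      simp only [Pi.add_apply, Pi.smul_apply, smul_eq_mul, Real.exp_neg]
      field_simp
      ring
    have hi : ∀ t i, geodesicCurve c v t i =
        Real.exp t / 2 * (P i + Real.exp (-t) * Real.exp (-t) * M i) := by
      intro t i
      rw [hcurve]
      simp only [Pi.add_apply, Pi.smul_apply, smul_eq_mul, Real.exp_neg]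
      field_simp
    have hnum : ∀ i, Filter.Tendsto (fun t : ℝ => ((P i +
        Real.exp (-t) * Real.exp (-t) * M i : ℝ) : ℂ)) Filter.atTop (𝓝 (P i : ℂ)) := by
      intro i
      refine (Complex.continuous_ofReal.tendsto _).comp ?_
      simpa using (hexp2.mul_const (M i)).const_add (P i)
    refine Filter.Tendsto.prodMk_nhds ?_ ?_
    · have h1 := ((hnum 1).add ((hnum 2).const_mul Complex.I)).div
        ((Complex.continuous_ofReal.tendsto _).comp hden)
        (by simpa using (Complex.ofReal_ne_zero.2 h0))
      refine h1.congr fun t => ?_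
      rw [Pi.div_apply, Function.comp_apply, hu, hi t 1, hi t 2]
      have : ((Real.exp t / 2 : ℝ) : ℂ) ≠ 0 := by
        rw [Complex.ofReal_ne_zero]; positivity
      rw [Complex.ofReal_mul (Real.exp t / 2), Complex.ofReal_mul (Real.exp t / 2),
        Complex.ofReal_mul (Real.exp t / 2), mul_left_comm Complex.I, ← mul_add,
        mul_div_mul_left _ _ this]
    · have h1 := (hexp.const_mul 2).div hden h0
      rw [mul_zero, zero_div] at h1
      refine h1.congr fun t => ?_
      simp only [Pi.div_apply]
      rw [hu, Real.exp_neg]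
      field_simp

theorem tendsToIdeal_atBot {c v : Mink4} (h : (c, v) ∈ UnitTangent3) :
    TendsToIdeal (geodesicCurve c v) Filter.atBot (idealPoint (c - v)) := by
  have h1 := tendsToIdeal_atTop (mem_UnitTangent3_neg h)
  rw [← sub_eq_add_neg] at h1
  refine (h1.comp Filter.tendsto_neg_atBot_atTop).congr fun t => ?_
  simp [geodesicCurve]

theorem tendsToIdeal_unique {γ : ℝ → Mink4} {l : Filter ℝ} [l.NeBot] {z z' : OnePoint ℂ}
    (h : TendsToIdeal γ l z) (h' : TendsToIdeal γ l z') : z = z' := by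
  have := tendsto_nhds_unique h h'
  exact Option.map_injective (fun a b hab => (Prod.ext_iff.1 hab).1) this

theorem tendsToIdeal_unique_iff {γ : ℝ → Mink4} {l : Filter ℝ} [l.NeBot] {z z' : OnePoint ℂ}
    (h : TendsToIdeal γ l z) : TendsToIdeal γ l z' ↔ z = z' :=
  ⟨tendsToIdeal_unique h, fun e => e ▸ h⟩

theorem idealPoint_eq_minus_iff {N : Mink4} (hN : lorentz N N = 0) (h0 : 0 < N 0) (z : ℂ) :
    idealPoint N = ((-z : ℂ) : OnePoint ℂ) ↔ ∃ y : ℝ, 0 < y ∧ N = y • rayMinus z := by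
  simp only [lorentz] at hN
  unfold idealPoint
  constructor
  · split_ifs with hk
    · intro h; exact absurd h (OnePoint.infty_ne_coe _)
    · intro h
      rw [OnePoint.coe_eq_coe, div_eq_iff (Complex.ofReal_ne_zero.2 hk)] at h
      have h1 := congrArg Complex.re h
      have h2 := congrArg Complex.im h
      simp at h1 h2
      have h3 : N 0 + N 3 = (N 0 - N 3) * (z.re ^ 2 + z.im ^ 2) := by
        apply mul_left_cancel₀ hk
        have : (N 0 - N 3) * (N 0 + N 3) = N 1 ^ 2 + N 2 ^ 2 := by linarith
        rw [this, h1, h2]; ring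
      refine ⟨N 0 - N 3, ?_, ?_⟩
      · have : 0 < (N 0 - N 3) * (1 + (z.re ^ 2 + z.im ^ 2)) := by linarith
        exact pos_of_mul_pos_left this (by positivity)
      · ext i
        fin_cases i <;> simp [rayMinus] <;> linarith
  · rintro ⟨y, hy, rfl⟩
    have e : (y • rayMinus z) 0 - (y • rayMinus z) 3 = y := by simp [rayMinus]; ring
    rw [e, if_neg hy.ne', OnePoint.coe_eq_coe, div_eq_iff (Complex.ofReal_ne_zero.2 hy.ne')]
    simp [rayMinus, Complex.ext_iff]
    constructor <;> ring

theorem idealPoint_eq_plus_iff {N : Mink4} (hN : lorentz N N = 0) (h0 : 0 < N 0) (z : ℂ) :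
    idealPoint N =
      (open Classical in if z = 0 then OnePoint.infty else (((conj z)⁻¹ : ℂ) : OnePoint ℂ)) ↔
      ∃ x : ℝ, 0 < x ∧ N = x • rayPlus z := by
  simp only [lorentz] at hN
  unfold idealPoint
  by_cases hz : z = 0
  · subst hz
    rw [if_pos rfl]
    constructor
    · split_ifs with hk
      · intro _
        have h3 : N 3 = N 0 := by linarith
        have h12 : N 1 ^ 2 + N 2 ^ 2 = 0 := by rw [h3] at hN; linarith
        have h1 : N 1 = 0 := by nlinarith [sq_nonneg (N 1), sq_nonneg (N 2)]
        have h2 : N 2 = 0 := by nlinarith [sq_nonneg (N 1), sq_nonneg (N 2)]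
        refine ⟨2 * N 0, by linarith, ?_⟩
        ext i
        fin_cases i <;> simp [rayPlus, h1, h2, h3] <;> ring
      · intro h; exact absurd h (OnePoint.coe_ne_infty _)
    · rintro ⟨x, hx, rfl⟩
      rw [if_pos]; simp [rayPlus]
  · rw [if_neg hz]
    have hn : z.re ^ 2 + z.im ^ 2 ≠ 0 := by
      intro h
      have h1 : z.re = 0 := by nlinarith [sq_nonneg z.re, sq_nonneg z.im]
      have h2 : z.im = 0 := by nlinarith [sq_nonneg z.re, sq_nonneg z.im]
      exact hz (Complex.ext h1 h2)
    have hc : conj z ≠ 0 := by simpa using hz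
    constructor
    · split_ifs with hk
      · intro h; exact absurd h (OnePoint.infty_ne_coe _)
      · intro h
        rw [OnePoint.coe_eq_coe, div_eq_iff (Complex.ofReal_ne_zero.2 hk), ← div_eq_inv_mul,
          eq_div_iff hc] at h
        have h1 := congrArg Complex.re h
        have h2 := congrArg Complex.im h
        simp at h1 h2
        set x := (N 0 - N 3) / (z.re ^ 2 + z.im ^ 2) with hx
        have hkx : N 0 - N 3 = x * (z.re ^ 2 + z.im ^ 2) := by rw [hx]; field_simp
        have n1 : N 1 = x * z.re := by
          apply mul_right_cancel₀ hn
          linear_combination z.re * h1 - z.im * h2 + z.re * hkx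
        have n2 : N 2 = x * z.im := by
          apply mul_right_cancel₀ hn
          linear_combination z.im * h1 + z.re * h2 + z.im * hkx
        have h3 : N 0 + N 3 = x := by
          apply mul_left_cancel₀ hk
          have : (N 0 - N 3) * (N 0 + N 3) = N 1 ^ 2 + N 2 ^ 2 := by linarith
          rw [this, n1, n2, hkx]; ring
        refine ⟨x, ?_, ?_⟩
        · have : 0 < x * (1 + (z.re ^ 2 + z.im ^ 2)) := by linarith
          exact pos_of_mul_pos_left this (by positivity)
        · ext i
          fin_cases i <;> simp [rayPlus] <;> linarith
    · rintro ⟨x, hx, rfl⟩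
      have e : (x • rayPlus z) 0 - (x • rayPlus z) 3 = x * (z.re ^ 2 + z.im ^ 2) := by
        simp [rayPlus]; ring
      have hk := mul_ne_zero hx.ne' hn
      rw [e, if_neg hk, OnePoint.coe_eq_coe, div_eq_iff (Complex.ofReal_ne_zero.2 hk),
        ← div_eq_inv_mul, eq_div_iff hc]
      simp [rayPlus, Complex.ext_iff, -Complex.ofReal_pow]
      constructor <;> ring

/-- A geodesic has coordinates `μ` exactly when its two null directions are spanned by the
standard null vectors of `μ₂` and `μ₁`. -/
theorem hasCoordinates_iff {c v : Mink4} (h : (c, v) ∈ UnitTangent3) (μ : ℂ × ℂ) :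
    HasCoordinates (geodesicCurve c v) μ ↔
      (∃ x : ℝ, 0 < x ∧ c + v = x • rayPlus μ.2) ∧ ∃ y : ℝ, 0 < y ∧ c - v = y • rayMinus μ.1 := by
  rw [HasCoordinates, tendsToIdeal_unique_iff (tendsToIdeal_atTop h),
    tendsToIdeal_unique_iff (tendsToIdeal_atBot h),
    idealPoint_eq_plus_iff (lorentz_end_self h) (end_time_pos h),
    idealPoint_eq_minus_iff (lorentz_start_self h) (start_time_pos h), and_comm]

theorem mul_mul_norm_sq_eq_four {c v : Mink4} (h : (c, v) ∈ UnitTangent3) {μ : ℂ × ℂ} {x y : ℝ}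
    (hx : c + v = x • rayPlus μ.2) (hy : c - v = y • rayMinus μ.1) :
    x * y * ‖1 + μ.1 * conj μ.2‖ ^ 2 = 4 := by
  have := lorentz_ends h
  rw [hx, hy, lorentz_smul_left, lorentz_smul_right, lorentz_rayPlus_rayMinus] at this
  linarith

theorem coord_mem_domain {c v : Mink4} (h : (c, v) ∈ UnitTangent3) {μ : ℂ × ℂ} {x y : ℝ}
    (hx : c + v = x • rayPlus μ.2) (hy : c - v = y • rayMinus μ.1) :
    1 + μ.1 * conj μ.2 ≠ 0 := by
  intro h0
  have := mul_mul_norm_sq_eq_four h hx hy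
  simp [h0] at this

/-- A geodesic with coordinates `μ` is the explicit one, up to a shift of the parameter. -/
theorem geodesicCurve_eq_geodesicOf {c v : Mink4} (h : (c, v) ∈ UnitTangent3) {μ : ℂ × ℂ}
    {x y : ℝ} (hx0 : 0 < x) (hy0 : 0 < y)
    (hx : c + v = x • rayPlus μ.2) (hy : c - v = y • rayMinus μ.1) (t : ℝ) :
    geodesicCurve c v t = geodesicOf μ (t + Real.log (x / y) / 2) := by
  have h4 := mul_mul_norm_sq_eq_four h hx hy
  have hD : 0 < ‖1 + μ.1 * conj μ.2‖ := norm_pos_iff.2 (coord_mem_domain h hx hy)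
  rw [geodesicCurve_eq, geodesicOf_eq, hx, hy]
  set d := ‖1 + μ.1 * conj μ.2‖
  set r := Real.exp (Real.log (x / y) / 2) with hr
  have hr0 : 0 < r := Real.exp_pos _
  have hr2 : r * r = x / y := by
    rw [hr, ← Real.exp_add, add_halves, Real.exp_log (by positivity)]
  have hrx : r = x * d / 2 := by
    have h2 : r ^ 2 = (x * d / 2) ^ 2 := by
      rw [sq, hr2, div_eq_iff hy0.ne']
      linear_combination (-x / 4) * h4
    exact (pow_left_inj₀ hr0.le (by positivity) two_ne_zero).1 h2
  have hri : r⁻¹ = y * d / 2 := by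
    rw [inv_eq_iff_eq_inv, eq_comm, inv_eq_iff_eq_inv, eq_comm]
    apply inv_eq_of_mul_eq_one_right
    rw [hrx]; linarith
  rw [neg_add, Real.exp_add, Real.exp_add, Real.exp_neg (Real.log (x / y) / 2), ← hr, hri, hrx,
    smul_add, smul_smul, smul_smul, smul_smul, smul_smul]
  congr 2 <;> field_simp

/-- The explicit curve as a geodesic `p cosh t + v sinh t`. -/
theorem geodesicOf_eq_geodesicCurve {μ : ℂ × ℂ} (hμ : 1 + μ.1 * conj μ.2 ≠ 0) :
    ∃ c v, (c, v) ∈ UnitTangent3 ∧ (∀ t, geodesicOf μ t = geodesicCurve c v t) ∧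
      c + v = (2 * ‖1 + μ.1 * conj μ.2‖⁻¹) • rayPlus μ.2 ∧
      c - v = (2 * ‖1 + μ.1 * conj μ.2‖⁻¹) • rayMinus μ.1 := by
  have hd : 0 < ‖1 + μ.1 * conj μ.2‖ := norm_pos_iff.2 hμ
  have h1 := lorentz_rayPlus_self μ.2
  have h2 := lorentz_rayMinus_self μ.1
  have h3 := lorentz_rayPlus_rayMinus μ
  have h3' := (lorentz_comm (rayMinus μ.1) (rayPlus μ.2)).trans h3
  have p1 : 0 < rayPlus μ.2 0 := by simp [rayPlus]; positivity
  have p2 : 0 < rayMinus μ.1 0 := by simp [rayMinus]; positivity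
  have h4 : ∀ t, geodesicOf μ t = ‖1 + μ.1 * conj μ.2‖⁻¹ •
      (Real.exp t • rayPlus μ.2 + Real.exp (-t) • rayMinus μ.1) := geodesicOf_eq μ
  generalize ‖1 + μ.1 * conj μ.2‖ = d at *
  generalize rayPlus μ.2 = P at *
  generalize rayMinus μ.1 = M at *
  refine ⟨d⁻¹ • (P + M), d⁻¹ • (P - M), ⟨⟨?_, ?_⟩, ?_, ?_⟩, fun t => ?_, ?_, ?_⟩
  · simp only [lorentz_add_left, lorentz_add_right, lorentz_smul_left, lorentz_smul_right,
      h1, h2, h3, h3']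
    field_simp; ring
  · simp only [Pi.smul_apply, Pi.add_apply, smul_eq_mul]; positivity
  · simp only [lorentz_sub_left, lorentz_sub_right, lorentz_smul_left, lorentz_smul_right,
      h1, h2, h3, h3']
    field_simp; ring
  · simp only [lorentz_add_left, lorentz_sub_right, lorentz_smul_left, lorentz_smul_right,
      h1, h2, h3, h3']
    field_simp; ring
  · rw [geodesicCurve_eq, h4]
    ext i
    simp; ring
  · ext i
    simp; ring
  · ext i
    simp; ring

theorem isUnitSpeedGeodesic_geodesicOf {μ : ℂ × ℂ} (hμ : 1 + μ.1 * conj μ.2 ≠ 0) :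
    IsUnitSpeedGeodesic (geodesicOf μ) := by
  obtain ⟨c, v, h, h1, -⟩ := geodesicOf_eq_geodesicCurve hμ
  exact ⟨c, v, h, h1⟩

theorem hasCoordinates_geodesicOf {μ : ℂ × ℂ} (hμ : 1 + μ.1 * conj μ.2 ≠ 0) :
    HasCoordinates (geodesicOf μ) μ := by
  obtain ⟨c, v, h, h1, h2, h3⟩ := geodesicOf_eq_geodesicCurve hμ
  have hd : 0 < ‖1 + μ.1 * conj μ.2‖ := norm_pos_iff.2 hμ
  rw [show geodesicOf μ = geodesicCurve c v from funext h1, hasCoordinates_iff h]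
  exact ⟨⟨_, by positivity, h2⟩, _, by positivity, h3⟩

/-! ### Representatives of oriented geodesics -/

theorem Represents.exists_shift {γ γ' : ℝ → Mink4} {ℓ : OrientedGeodesics}
    (h : Represents γ ℓ) (h' : Represents γ' ℓ) : ∃ t₀ : ℝ, ∀ t, γ (t + t₀) = γ' t := by
  obtain ⟨g, rfl⟩ := h
  obtain ⟨g', e⟩ := h'
  exact Quotient.exact e.symm

theorem HasCoordinates.shift {γ : ℝ → Mink4} {μ : ℂ × ℂ} (h : HasCoordinates γ μ) (t₀ : ℝ) :
    HasCoordinates (fun t => γ (t + t₀)) μ :=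
  ⟨h.1.comp (Filter.tendsto_atBot_add_const_right _ t₀ Filter.tendsto_id),
    h.2.comp (Filter.tendsto_atTop_add_const_right _ t₀ Filter.tendsto_id)⟩

/-- The null directions of a representative of an oriented geodesic, in terms of its
coordinates. -/
theorem HasCoordinatesAfter.exists_rays {a : SL(2, ℂ)} {ℓ : OrientedGeodesics} {μ : ℂ × ℂ}
    {c v : Mink4} (h : HasCoordinatesAfter a ℓ μ) (hr : Represents (geodesicCurve c v) ℓ)
    (hu : (c, v) ∈ UnitTangent3) :
    (∃ x : ℝ, 0 < x ∧ isomAct a (c + v) = x • rayPlus μ.2) ∧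
      ∃ y : ℝ, 0 < y ∧ isomAct a (c - v) = y • rayMinus μ.1 := by
  obtain ⟨γ, h1, h2⟩ := h
  obtain ⟨t₀, ht⟩ := h1.exists_shift hr
  have h3 := h2.shift t₀
  simp only [ht, isomAct_geodesicCurve] at h3
  have h4 := (hasCoordinates_iff (mem_UnitTangent3_isomAct a hu) μ).1 h3
  rwa [← isomAct_add, ← isomAct_sub] at h4

/-! ### The null-causal condition on first-order jets -/

/-- The derivative of `rayPlus` at `z` in the direction `w`. -/
noncomputable def dRayPlus (z w : ℂ) : Mink4 :=
  ![z.re * w.re + z.im * w.im, w.re, w.im, -(z.re * w.re + z.im * w.im)]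

/-- The derivative of `rayMinus` at `z` in the direction `w`. -/
noncomputable def dRayMinus (z w : ℂ) : Mink4 :=
  ![z.re * w.re + z.im * w.im, -w.re, -w.im, z.re * w.re + z.im * w.im]

/-- The first-order jet at `s` of the family of geodesics `c cosh t + v sinh t` is that of an
extrinsically flat surface. -/
def IsFlatJet (c v c' v' : Mink4) : Prop := det4 c v c' v' = 0

/-- The first-order jet at `s` of the family of geodesics `c cosh t + v sinh t` is that of an
immersion, at every parameter `t`. -/
def IsImmersedJet (c v c' v' : Mink4) : Prop :=
  ∀ t k l : ℝ, Real.cosh t • c' + Real.sinh t • v' ≠ k • c + l • v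

theorem isFlatJet_isomAct_iff (a : SL(2, ℂ)) {c v c' v' : Mink4} :
    IsFlatJet (isomAct a c) (isomAct a v) (isomAct a c') (isomAct a v') ↔ IsFlatJet c v c' v' :=
  det4_isomAct_eq_zero_iff a c v c' v'

theorem isImmersedJet_isomAct_iff (a : SL(2, ℂ)) {c v c' v' : Mink4} :
    IsImmersedJet (isomAct a c) (isomAct a v) (isomAct a c') (isomAct a v') ↔
      IsImmersedJet c v c' v' := by
  simp only [IsImmersedJet, ← isomAct_smul, ← isomAct_add, ne_eq, (isomAct_injective a).eq_iff]

/-- The normal component, as a complex number, of a vector along the geodesic with coordinates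
`μ`: with `ξ = (1, μ̄₂)` and `η = (-μ₁, 1)` the null vectors of `μ` are `ξ ξ*` and `η η*`, and
this is `|1 + μ₁ μ̄₂|²` times the coefficient of `η ξ*` of the Hermitian matrix `N`. -/
noncomputable def normalPart (μ : ℂ × ℂ) (N : Mink4) : ℂ :=
  -conj μ.2 * ((N 0 : ℂ) + N 3) - conj μ.1 * conj μ.2 * ((N 1 : ℂ) + Complex.I * N 2)
    + ((N 1 : ℂ) - Complex.I * N 2) + conj μ.1 * ((N 0 : ℂ) - N 3)

theorem normalPart_add (μ : ℂ × ℂ) (N N' : Mink4) :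
    normalPart μ (N + N') = normalPart μ N + normalPart μ N' := by
  simp only [normalPart, Pi.add_apply, Complex.ofReal_add]; ring

theorem normalPart_smul (μ : ℂ × ℂ) (k : ℝ) (N : Mink4) :
    normalPart μ (k • N) = k * normalPart μ N := by
  simp only [normalPart, Pi.smul_apply, smul_eq_mul, Complex.ofReal_mul]; ring

theorem normalPart_rayPlus (μ : ℂ × ℂ) : normalPart μ (rayPlus μ.2) = 0 := by
  apply Complex.ext <;> simp [normalPart, rayPlus] <;> simp [← Complex.ofReal_pow] <;> ring

theorem normalPart_rayMinus (μ : ℂ × ℂ) : normalPart μ (rayMinus μ.1) = 0 := by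
  apply Complex.ext <;> simp [normalPart, rayMinus] <;> simp [← Complex.ofReal_pow] <;> ring

theorem normalPart_dRayPlus (μ : ℂ × ℂ) (w : ℂ) :
    normalPart μ (dRayPlus μ.2 w) = conj w * conj (1 + μ.1 * conj μ.2) := by
  apply Complex.ext <;> simp [normalPart, dRayPlus] <;> ring

theorem normalPart_dRayMinus (μ : ℂ × ℂ) (w : ℂ) :
    normalPart μ (dRayMinus μ.1 w) = -(conj w * (1 + μ.1 * conj μ.2)) := by
  apply Complex.ext <;> simp [normalPart, dRayMinus] <;> ring

/-- A vector without normal component lies in the plane of the geodesic. -/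
theorem eq_comb_of_normalPart_eq_zero {μ : ℂ × ℂ} (hμ : 1 + μ.1 * conj μ.2 ≠ 0) {N : Mink4}
    (h : normalPart μ N = 0) : ∃ k l : ℝ, N = k • rayPlus μ.2 + l • rayMinus μ.1 := by
  have hD : Complex.normSq (1 + μ.1 * conj μ.2) ≠ 0 := by simpa using hμ
  have hre := congrArg Complex.re h
  have him := congrArg Complex.im h
  obtain ⟨⟨a, b⟩, ⟨d, e⟩⟩ := μ
  simp only [normalPart, Complex.zero_re, Complex.zero_im] at hre him
  simp at hre him
  refine ⟨-2 * lorentz N (rayMinus ⟨a, b⟩) / Complex.normSq (1 + (⟨a, b⟩ : ℂ) * conj ⟨d, e⟩),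
    -2 * lorentz N (rayPlus ⟨d, e⟩) / Complex.normSq (1 + (⟨a, b⟩ : ℂ) * conj ⟨d, e⟩), ?_⟩
  ext i
  simp only [Pi.add_apply, Pi.smul_apply, smul_eq_mul]
  -- up to the factor, the difference of both sides is `normalPart μ N • η ξ*` plus its adjoint
  rw [div_mul_eq_mul_div, div_mul_eq_mul_div, ← add_div, eq_div_iff hD]
  fin_cases i <;>
    simp [lorentz, rayPlus, rayMinus, Complex.normSq_apply]
  · linear_combination (d - a) * hre - (e - b) * him
  · linear_combination (1 - (a * d - b * e)) * hre + (a * e + b * d) * him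
  · linear_combination (-(a * e + b * d)) * hre + (-1 - (a * d - b * e)) * him
  · linear_combination (-(a + d)) * hre + (b + e) * him

theorem det4_rays (μ w : ℂ × ℂ) :
    det4 (rayPlus μ.2) (rayMinus μ.1) (dRayPlus μ.2 w.2) (dRayMinus μ.1 w.1) =
      (w.1 * conj w.2 * conj (1 + μ.1 * conj μ.2) ^ 2).im / 2 := by
  simp [det4, lorentz, tripleProd, minor3, rayPlus, rayMinus, dRayPlus, dRayMinus, sq]
  ring

theorem det4_ends (c v c' v' : Mink4) :
    det4 (c + v) (c - v) (c' + v') (c' - v') = 4 * det4 c v c' v' := by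
  simp [det4, lorentz, tripleProd, minor3]; ring

theorem det4_scale (P M P' M' : Mink4) (x y x' y' : ℝ) :
    det4 (x • P) (y • M) (x' • P + x • P') (y' • M + y • M') = x ^ 2 * y ^ 2 * det4 P M P' M' := by
  simp [det4, lorentz, tripleProd, minor3]; ring

/-- The jet of a curve of geodesics is flat and immersed exactly when the curve is null-causal
there: flatness is the vanishing of `𝒢ⁱ`, and, given this, some point of the geodesic is singular
exactly when `𝒢ʳ` is positive or the velocity vanishes. -/
theorem isFlatJet_and_isImmersedJet_iff {c v c' v' : Mink4} {μ w : ℂ × ℂ} {x y x' y' : ℝ}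
    (hμ : 1 + μ.1 * conj μ.2 ≠ 0) (hx0 : 0 < x) (hy0 : 0 < y)
    (hx : c + v = x • rayPlus μ.2) (hy : c - v = y • rayMinus μ.1)
    (hx' : c' + v' = x' • rayPlus μ.2 + x • dRayPlus μ.2 w.2)
    (hy' : c' - v' = y' • rayMinus μ.1 + y • dRayMinus μ.1 w.1) :
    IsFlatJet c v c' v' ∧ IsImmersedJet c v c' v' ↔
      w ≠ 0 ∧ metricIm μ w = 0 ∧ metricRe μ w ≤ 0 := by
  have half : ∀ a b : Mink4, a = (1 / 2 : ℝ) • (a + b) + (1 / 2 : ℝ) • (a - b) ∧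
      b = (1 / 2 : ℝ) • (a + b) + (-1 / 2 : ℝ) • (a - b) := by
    intro a b
    constructor <;> ext i <;> simp <;> ring
  have hG : 4 * (w.1 * conj w.2) = metricG μ w * (1 + μ.1 * conj μ.2) ^ 2 := by
    rw [metricG, div_mul_cancel₀ _ (pow_ne_zero 2 hμ)]; ring
  have hflat : IsFlatJet c v c' v' ↔ metricIm μ w = 0 := by
    have h1 := det4_ends c v c' v'
    rw [hx, hy, hx', hy', det4_scale, det4_rays] at h1
    have h2 : (w.1 * conj w.2 * conj (1 + μ.1 * conj μ.2) ^ 2).im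
        = metricIm μ w * Complex.normSq (1 + μ.1 * conj μ.2) ^ 2 / 4 := by
      have : w.1 * conj w.2 * conj (1 + μ.1 * conj μ.2) ^ 2
          = ((Complex.normSq (1 + μ.1 * conj μ.2) ^ 2 / 4 : ℝ) : ℂ) * metricG μ w := by
        push_cast
        rw [← Complex.mul_conj]
        linear_combination (conj (1 + μ.1 * conj μ.2) ^ 2 / 4) * hG
      rw [this, Complex.im_ofReal_mul, metricIm]
      ring
    rw [h2] at h1
    have hn : Complex.normSq (1 + μ.1 * conj μ.2) ≠ 0 := by simpa using hμ
    rw [IsFlatJet]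
    constructor
    · intro h
      rw [h] at h1
      simpa [hx0.ne', hy0.ne', hn] using h1
    · intro h
      rw [h] at h1
      simpa using h1.symm
  have hcomb : ∀ t, normalPart μ (Real.cosh t • c' + Real.sinh t • v') =
      ((Real.exp t * x : ℝ) * (conj w.2 * conj (1 + μ.1 * conj μ.2))
        - (Real.exp (-t) * y : ℝ) * (conj w.1 * (1 + μ.1 * conj μ.2))) / 2 := by
    intro t
    have : Real.cosh t • c' + Real.sinh t • v' =
        (Real.exp t / 2) • (c' + v') + (Real.exp (-t) / 2) • (c' - v') := geodesicCurve_eq c' v' t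
    rw [this, hx', hy']
    simp only [normalPart_add, normalPart_smul, normalPart_rayPlus, normalPart_rayMinus,
      normalPart_dRayPlus, normalPart_dRayMinus]
    push_cast
    ring
  have himm : IsImmersedJet c v c' v' ↔ ∀ t : ℝ,
      ((Real.exp t * x : ℝ) : ℂ) * (conj w.2 * conj (1 + μ.1 * conj μ.2))
        ≠ (Real.exp (-t) * y : ℝ) * (conj w.1 * (1 + μ.1 * conj μ.2)) := by
    refine forall_congr' fun t => ?_
    constructor
    · intro h he
      have h0 : normalPart μ (Real.cosh t • c' + Real.sinh t • v') = 0 := by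
        rw [hcomb, he, sub_self, zero_div]
      obtain ⟨k, l, hkl⟩ := eq_comb_of_normalPart_eq_zero hμ h0
      refine h (k / x + l / y) (k / x - l / y) ?_
      have eP : rayPlus μ.2 = x⁻¹ • (c + v) := by
        rw [hx, smul_smul, inv_mul_cancel₀ hx0.ne', one_smul]
      have eM : rayMinus μ.1 = y⁻¹ • (c - v) := by
        rw [hy, smul_smul, inv_mul_cancel₀ hy0.ne', one_smul]
      rw [hkl, eP, eM]
      ext i
      simp; ring
    · intro h k l he
      apply h
      have h0 : normalPart μ (Real.cosh t • c' + Real.sinh t • v') = 0 := by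
        have hc : normalPart μ c = 0 := by
          rw [(half c v).1, hx, hy]
          simp only [normalPart_add, normalPart_smul, normalPart_rayPlus, normalPart_rayMinus,
            mul_zero, add_zero]
        have hv : normalPart μ v = 0 := by
          rw [(half c v).2, hx, hy]
          simp only [normalPart_add, normalPart_smul, normalPart_rayPlus, normalPart_rayMinus,
            mul_zero, add_zero]
        rw [he, normalPart_add, normalPart_smul, normalPart_smul, hc, hv, mul_zero, mul_zero,
          add_zero]
      rw [hcomb] at h0
      linear_combination 2 * h0
  rw [hflat, himm]
  have hGre : metricIm μ w = 0 → metricG μ w = (metricRe μ w : ℂ) := fun h =>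
    Complex.ext (by simp [metricRe]) (by rw [Complex.ofReal_im]; exact h)
  have hcore : metricIm μ w = 0 → ∀ A B : ℝ,
      (A : ℂ) * (conj w.2 * conj (1 + μ.1 * conj μ.2)) = B * (conj w.1 * (1 + μ.1 * conj μ.2)) →
      4 * A * Complex.normSq w.2 = B * metricRe μ w * Complex.normSq (1 + μ.1 * conj μ.2) := by
    intro h A B he
    have hc := congrArg conj hG
    rw [hGre h] at hc
    simp only [map_mul, map_pow, Complex.conj_conj, Complex.conj_ofReal, map_ofNat] at hc
    have hDc : conj (1 + μ.1 * conj μ.2) ≠ 0 := (map_ne_zero _).2 hμ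
    have : ((4 * A * Complex.normSq w.2 : ℝ) : ℂ) =
        ((B * metricRe μ w * Complex.normSq (1 + μ.1 * conj μ.2) : ℝ) : ℂ) := by
      apply mul_right_cancel₀ hDc
      push_cast
      rw [← Complex.mul_conj, ← Complex.mul_conj]
      linear_combination (4 * w.2) * he + (B * (1 + μ.1 * conj μ.2)) * hc
    exact_mod_cast this
  have hD : 0 < Complex.normSq (1 + μ.1 * conj μ.2) := Complex.normSq_pos.2 hμ
  constructor
  · rintro ⟨him, hne⟩
    refine ⟨?_, him, ?_⟩
    · rintro rfl
      exact hne 0 (by simp)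
    · by_contra hpos
      push Not at hpos
      have hw : w.2 ≠ 0 := by
        intro h0
        rw [metricRe, metricG, h0] at hpos
        simp at hpos
      have hw2 : 0 < Complex.normSq w.2 := Complex.normSq_pos.2 hw
      set r := y * metricRe μ w * Complex.normSq (1 + μ.1 * conj μ.2) /
        (4 * x * Complex.normSq w.2) with hr
      have hr0 : 0 < r := by positivity
      -- the singular point of the geodesic
      refine hne (Real.log r / 2) ?_
      have hE : Real.exp (Real.log r / 2) * Real.exp (Real.log r / 2) = r := by
        rw [← Real.exp_add, add_halves, Real.exp_log hr0]
      have hc := congrArg conj hG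
      rw [hGre him] at hc
      simp only [map_mul, map_pow, Complex.conj_conj, Complex.conj_ofReal, map_ofNat] at hc
      rw [Real.exp_neg]
      set E := Real.exp (Real.log r / 2)
      have hE0 : E ≠ 0 := (Real.exp_pos _).ne'
      have hreal : 4 * (E * x) * Complex.normSq w.2 =
          E⁻¹ * y * metricRe μ w * Complex.normSq (1 + μ.1 * conj μ.2) := by
        apply mul_left_cancel₀ hE0
        have : r * (4 * x * Complex.normSq w.2) =
            y * metricRe μ w * Complex.normSq (1 + μ.1 * conj μ.2) := by
          rw [hr]; field_simp
        rw [← hE] at this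
        have hEi : E * E⁻¹ = 1 := mul_inv_cancel₀ hE0
        linear_combination this - y * metricRe μ w * Complex.normSq (1 + μ.1 * conj μ.2) * hEi
      have hcx : (4 : ℂ) * (E * x) * (w.2 * conj w.2) = E⁻¹ * y * metricRe μ w *
          ((1 + μ.1 * conj μ.2) * conj (1 + μ.1 * conj μ.2)) := by
        rw [Complex.mul_conj, Complex.mul_conj]
        exact_mod_cast hreal
      apply mul_left_cancel₀ (mul_ne_zero (by norm_num : (4 : ℂ) ≠ 0) hw)
      push_cast at hcx ⊢
      linear_combination (conj (1 + μ.1 * conj μ.2)) * hcx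
        - ((E : ℂ)⁻¹ * y * (1 + μ.1 * conj μ.2)) * hc
  · rintro ⟨hw, him, hre⟩
    refine ⟨him, fun t he => hw ?_⟩
    have h1 := hcore him _ _ he
    have hA : 0 < Real.exp t * x := by positivity
    have hB : 0 < Real.exp (-t) * y := by positivity
    have h2 : Complex.normSq w.2 = 0 := by
      have h3 : 4 * (Real.exp t * x) * Complex.normSq w.2 ≤ 0 := by
        rw [h1, mul_assoc]
        exact mul_nonpos_of_nonneg_of_nonpos hB.le (mul_nonpos_of_nonpos_of_nonneg hre hD.le)
      exact le_antisymm (nonpos_of_mul_nonpos_right h3 (by positivity)) (Complex.normSq_nonneg _)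
    have h2' : w.2 = 0 := by simpa using h2
    rw [h2'] at he
    have h3 : w.1 = 0 := by
      have hB' : ((Real.exp (-t) * y : ℝ) : ℂ) ≠ 0 := Complex.ofReal_ne_zero.2 hB.ne'
      have := he.symm
      rw [map_zero, zero_mul, mul_zero] at this
      simpa [hB', hμ] using (mul_eq_zero.1 this).resolve_left hB'
    exact Prod.ext h3 h2'

/-! ### Parametrized surfaces -/

/-- `F` is a smooth immersion of the open set `U` of the plane into `ℍ³`. -/
structure IsPatch (F : ℝ × ℝ → Mink4) (U : Set (ℝ × ℝ)) : Prop where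
  isOpen : IsOpen U
  smooth : ContDiffOn ℝ ∞ F U
  mem_hyp : ∀ x ∈ U, F x ∈ Hyp3
  immersion : ∀ x ∈ U, Function.Injective (fderiv ℝ F x)

theorem hasFDerivAt_lorentz {A B : ℝ × ℝ → Mink4} {A' B' : ℝ × ℝ →L[ℝ] Mink4} {x : ℝ × ℝ}
    (hA : HasFDerivAt A A' x) (hB : HasFDerivAt B B' x) (e : ℝ × ℝ) :
    fderiv ℝ (fun y => lorentz (A y) (B y)) x e = lorentz (A' e) (B x) + lorentz (A x) (B' e) := by
  have hA' := hasFDerivAt_pi'.1 hA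
  have hB' := hasFDerivAt_pi'.1 hB
  have h := ((((hA' 0).mul (hB' 0)).neg.add ((hA' 1).mul (hB' 1))).add
    ((hA' 2).mul (hB' 2))).add ((hA' 3).mul (hB' 3))
  have h2 : HasFDerivAt (fun y => lorentz (A y) (B y)) _ x := h
  rw [h2.fderiv]
  simp [lorentz]
  ring

/-- Leibniz' rule for two vector fields with constant scalar product. -/
theorem lorentz_fderiv_add_eq_zero {A B : ℝ × ℝ → Mink4} {x : ℝ × ℝ} {k : ℝ}
    (hA : DifferentiableAt ℝ A x) (hB : DifferentiableAt ℝ B x)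
    (h : ∀ᶠ y in 𝓝 x, lorentz (A y) (B y) = k) (e : ℝ × ℝ) :
    lorentz (fderiv ℝ A x e) (B x) + lorentz (A x) (fderiv ℝ B x e) = 0 := by
  rw [← hasFDerivAt_lorentz hA.hasFDerivAt hB.hasFDerivAt,
    Filter.EventuallyEq.fderiv_eq (f₁ := fun y => lorentz (A y) (B y)) (f := fun _ => k) h]
  simp

theorem contDiffOn_lorentz {E : Type*} [NormedAddCommGroup E] [NormedSpace ℝ E]
    {n : WithTop ℕ∞} {A B : E → Mink4} {U : Set E}
    (hA : ContDiffOn ℝ n A U) (hB : ContDiffOn ℝ n B U) :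
    ContDiffOn ℝ n (fun y => lorentz (A y) (B y)) U := by
  have hA' := contDiffOn_pi.1 hA
  have hB' := contDiffOn_pi.1 hB
  exact ((((hA' 0).mul (hB' 0)).neg.add ((hA' 1).mul (hB' 1))).add
    ((hA' 2).mul (hB' 2))).add ((hA' 3).mul (hB' 3))

theorem contDiffOn_tripleProd {E : Type*} [NormedAddCommGroup E] [NormedSpace ℝ E]
    {n : WithTop ℕ∞} {A B C : E → Mink4} {U : Set E}
    (hA : ContDiffOn ℝ n A U) (hB : ContDiffOn ℝ n B U) (hC : ContDiffOn ℝ n C U) :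
    ContDiffOn ℝ n (fun y => tripleProd (A y) (B y) (C y)) U := by
  have hA' := contDiffOn_pi.1 hA
  have hB' := contDiffOn_pi.1 hB
  have hC' := contDiffOn_pi.1 hC
  have hm : ∀ i j k, ContDiffOn ℝ n (fun y => minor3 i j k (A y) (B y) (C y)) U := fun i j k =>
    (((hA' i).mul (((hB' j).mul (hC' k)).sub ((hB' k).mul (hC' j)))).sub
      ((hA' j).mul (((hB' i).mul (hC' k)).sub ((hB' k).mul (hC' i))))).add
      ((hA' k).mul (((hB' i).mul (hC' j)).sub ((hB' j).mul (hC' i))))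
  rw [contDiffOn_pi]
  intro i
  fin_cases i
  · exact hm 1 2 3
  · exact hm 0 2 3
  · exact (hm 0 1 3).neg
  · exact hm 0 1 2

theorem fderiv_apply_eq (F : ℝ × ℝ → Mink4) (x e : ℝ × ℝ) :
    fderiv ℝ F x e = e.1 • partialS F x + e.2 • partialT F x := by
  rw [partialS, partialT, ← map_smul, ← map_smul, ← map_add]
  simp

namespace IsPatch

variable {F : ℝ × ℝ → Mink4} {U : Set (ℝ × ℝ)}

theorem differentiableAt (h : IsPatch F U) {x : ℝ × ℝ} (hx : x ∈ U) : DifferentiableAt ℝ F x :=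
  (h.smooth.contDiffAt (h.isOpen.mem_nhds hx)).differentiableAt (by simp)

theorem lorentz_fderiv (h : IsPatch F U) {x : ℝ × ℝ} (hx : x ∈ U) (e : ℝ × ℝ) :
    lorentz (F x) (fderiv ℝ F x e) = 0 := by
  have := lorentz_fderiv_add_eq_zero (k := -1) (h.differentiableAt hx) (h.differentiableAt hx)
    (Filter.eventually_of_mem (h.isOpen.mem_nhds hx) fun y hy => (h.mem_hyp y hy).1) e
  linarith [lorentz_comm (F x) (fderiv ℝ F x e)]

theorem contDiffOn_fderiv_apply (h : IsPatch F U) (e : ℝ × ℝ) :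
    ContDiffOn ℝ ∞ (fun x => fderiv ℝ F x e) U :=
  (h.smooth.fderiv_of_isOpen h.isOpen (by simp)).clm_apply contDiffOn_const

/-- The first fundamental form is positive definite. -/
theorem gram_pos (h : IsPatch F U) {x : ℝ × ℝ} (hx : x ∈ U) :
    0 < lorentz (partialS F x) (partialS F x) * lorentz (partialT F x) (partialT F x)
      - lorentz (partialS F x) (partialT F x) ^ 2 := by
  have hp := (h.mem_hyp x hx).1
  have hpos : ∀ e : ℝ × ℝ, e ≠ 0 → 0 < lorentz (fderiv ℝ F x e) (fderiv ℝ F x e) := by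
    intro e he
    refine lorentz_self_pos hp (h.lorentz_fderiv hx e) fun h0 => he ?_
    exact h.immersion x hx (h0.trans (map_zero _).symm)
  have hG : 0 < lorentz (partialT F x) (partialT F x) :=
    hpos (0, 1) (by simp [Prod.ext_iff])
  have hE := hpos (lorentz (partialT F x) (partialT F x), -lorentz (partialS F x) (partialT F x))
    (by simp [Prod.ext_iff, hG.ne'])
  rw [fderiv_apply_eq] at hE
  simp only [lorentz_add_left, lorentz_add_right, lorentz_smul_left, lorentz_smul_right,
    lorentz_comm (partialT F x) (partialS F x)] at hE
  rw [← mul_pos_iff_of_pos_left hG]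
  linarith

theorem crossAt_eq (h : IsPatch F U) {x : ℝ × ℝ} (hx : x ∈ U) :
    crossAt (F x) (partialS F x) (partialT F x) =
      tripleProd (F x) (partialS F x) (partialT F x) :=
  crossAt_eq_tripleProd (h.mem_hyp x hx).1 _ _

theorem lorentz_cross_self (h : IsPatch F U) {x : ℝ × ℝ} (hx : x ∈ U) :
    lorentz (tripleProd (F x) (partialS F x) (partialT F x))
      (tripleProd (F x) (partialS F x) (partialT F x)) =
    lorentz (partialS F x) (partialS F x) * lorentz (partialT F x) (partialT F x)
      - lorentz (partialS F x) (partialT F x) ^ 2 := by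
  rw [lorentz_tripleProd_tripleProd, (h.mem_hyp x hx).1, partialS, partialT,
    h.lorentz_fderiv hx, h.lorentz_fderiv hx]
  ring

theorem unitNormal_eq (h : IsPatch F U) {x : ℝ × ℝ} (hx : x ∈ U) :
    unitNormal F x = (Real.sqrt (lorentz (tripleProd (F x) (partialS F x) (partialT F x))
      (tripleProd (F x) (partialS F x) (partialT F x))))⁻¹ •
      tripleProd (F x) (partialS F x) (partialT F x) := by
  rw [unitNormal, h.crossAt_eq hx]

theorem contDiffOn_unitNormal (h : IsPatch F U) : ContDiffOn ℝ ∞ (unitNormal F) U := by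
  have hC : ContDiffOn ℝ ∞ (fun x => tripleProd (F x) (partialS F x) (partialT F x)) U :=
    contDiffOn_tripleProd h.smooth (h.contDiffOn_fderiv_apply (1, 0))
      (h.contDiffOn_fderiv_apply (0, 1))
  have hne : ∀ x ∈ U, 0 < lorentz (tripleProd (F x) (partialS F x) (partialT F x))
      (tripleProd (F x) (partialS F x) (partialT F x)) := by
    intro x hx
    rw [h.lorentz_cross_self hx]
    exact h.gram_pos hx
  refine ContDiffOn.congr ?_ fun x hx => h.unitNormal_eq hx
  exact (((contDiffOn_lorentz hC hC).sqrt fun x hx => (hne x hx).ne').inv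
    fun x hx => (Real.sqrt_pos.2 (hne x hx)).ne').smul hC

theorem differentiableAt_unitNormal (h : IsPatch F U) {x : ℝ × ℝ} (hx : x ∈ U) :
    DifferentiableAt ℝ (unitNormal F) x :=
  (h.contDiffOn_unitNormal.contDiffAt (h.isOpen.mem_nhds hx)).differentiableAt (by simp)

/-- The determinant of the second fundamental form decides whether the curvature vanishes. -/
theorem extCurvaturePatch_eq_zero_iff (h : IsPatch F U) {x : ℝ × ℝ} (hx : x ∈ U) :
    extCurvaturePatch F x = 0 ↔
      lorentz (partialS F x) (partialS (unitNormal F) x)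
        * lorentz (partialT F x) (partialT (unitNormal F) x)
      - lorentz (partialS F x) (partialT (unitNormal F) x)
        * lorentz (partialT F x) (partialS (unitNormal F) x) = 0 := by
  rw [extCurvaturePatch, div_eq_zero_iff, or_iff_left (h.gram_pos hx).ne']

/-- Vanishing of the extrinsic curvature does not depend on the coordinates: a change of
coordinates multiplies the second fundamental form by a locally constant sign. -/
theorem extCurvaturePatch_comp (h : IsPatch F U) {G : ℝ × ℝ → Mink4} {V : Set (ℝ × ℝ)}
    (hG : IsPatch G V) {θ : ℝ × ℝ → ℝ × ℝ} (hθ : ContDiffOn ℝ ∞ θ V) (hm : Set.MapsTo θ V U)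
    (he : ∀ y ∈ V, G y = F (θ y)) {x : ℝ × ℝ} (hx : x ∈ V)
    (h0 : extCurvaturePatch G x = 0) : extCurvaturePatch F (θ x) = 0 := by
  rw [hG.extCurvaturePatch_eq_zero_iff hx] at h0
  rw [h.extCurvaturePatch_eq_zero_iff (hm hx)]
  have hθd : ∀ y ∈ V, DifferentiableAt ℝ θ y := fun y hy =>
    (hθ.contDiffAt (hG.isOpen.mem_nhds hy)).differentiableAt (by simp)
  have hfd : ∀ y ∈ V, ∀ e, fderiv ℝ G y e = fderiv ℝ F (θ y) (fderiv ℝ θ y e) := by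
    intro y hy e
    have : G =ᶠ[𝓝 y] F ∘ θ := Filter.eventually_of_mem (hG.isOpen.mem_nhds hy) he
    rw [this.fderiv_eq, fderiv_comp y (h.differentiableAt (hm hy)) (hθd y hy)]
    rfl
  set δ : ℝ × ℝ → ℝ := fun y => (fderiv ℝ θ y (1, 0)).1 * (fderiv ℝ θ y (0, 1)).2
    - (fderiv ℝ θ y (1, 0)).2 * (fderiv ℝ θ y (0, 1)).1 with hδ
  have hcross : ∀ y ∈ V, tripleProd (G y) (partialS G y) (partialT G y) =
      δ y • tripleProd (F (θ y)) (partialS F (θ y)) (partialT F (θ y)) := by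
    intro y hy
    rw [he y hy, partialS, partialT, hfd y hy, hfd y hy, fderiv_apply_eq, fderiv_apply_eq F,
      tripleProd_smul_comb]
  have hδ0 : ∀ y ∈ V, δ y ≠ 0 := by
    intro y hy h0
    have h1 := hG.gram_pos hy
    rw [← hG.lorentz_cross_self hy, hcross y hy, h0, zero_smul, lorentz_zero_left] at h1
    exact lt_irrefl _ h1
  have hδc : ContinuousAt δ x := by
    have hc : ContinuousAt (fun y => fderiv ℝ θ y) x :=
      ((hθ.fderiv_of_isOpen (m := ∞) hG.isOpen (by simp)).continuousOn).continuousAt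
        (hG.isOpen.mem_nhds hx)
    have h1 := hc.clm_apply (continuousAt_const (y := ((1 : ℝ), (0 : ℝ))))
    have h2 := hc.clm_apply (continuousAt_const (y := ((0 : ℝ), (1 : ℝ))))
    exact (h1.fst.mul h2.snd).sub (h1.snd.mul h2.fst)
  have hsign : ∀ᶠ y in 𝓝 x, |δ y|⁻¹ * δ y = |δ x|⁻¹ * δ x := by
    rcases lt_or_gt_of_ne (hδ0 x hx) with hneg | hpos
    · filter_upwards [hδc.eventually (gt_mem_nhds hneg)] with y hy
      rw [abs_of_neg hy, abs_of_neg hneg, inv_neg, inv_neg, neg_mul, neg_mul,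
        inv_mul_cancel₀ hy.ne, inv_mul_cancel₀ hneg.ne]
    · filter_upwards [hδc.eventually (lt_mem_nhds hpos)] with y hy
      rw [abs_of_pos hy, abs_of_pos hpos, inv_mul_cancel₀ hy.ne', inv_mul_cancel₀ hpos.ne']
  set ε := |δ x|⁻¹ * δ x with hε
  have hε0 : ε ≠ 0 := mul_ne_zero (inv_ne_zero (abs_ne_zero.2 (hδ0 x hx))) (hδ0 x hx)
  have hN : unitNormal G =ᶠ[𝓝 x] fun y => ε • unitNormal F (θ y) := by
    filter_upwards [hsign, hG.isOpen.mem_nhds hx] with y hy hyV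
    rw [hG.unitNormal_eq hyV, h.unitNormal_eq (hm hyV), hcross y hyV, lorentz_smul_left,
      lorentz_smul_right, ← mul_assoc, Real.sqrt_mul (mul_self_nonneg _), Real.sqrt_mul_self_eq_abs,
      mul_inv, smul_smul, smul_smul, ← hy]
    congr 1
    ring
  have hNfd : ∀ e, fderiv ℝ (unitNormal G) x e =
      ε • fderiv ℝ (unitNormal F) (θ x) (fderiv ℝ θ x e) := by
    intro e
    have hd : DifferentiableAt ℝ (unitNormal F ∘ θ) x :=
      (h.differentiableAt_unitNormal (hm hx)).comp x (hθd x hx)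
    rw [hN.fderiv_eq]
    change fderiv ℝ (ε • (unitNormal F ∘ θ)) x e = _
    rw [fderiv_const_smul hd, fderiv_comp x (h.differentiableAt_unitNormal (hm hx)) (hθd x hx)]
    rfl
  have key : (ε * δ x) ^ 2 * (lorentz (partialS F (θ x)) (partialS (unitNormal F) (θ x))
        * lorentz (partialT F (θ x)) (partialT (unitNormal F) (θ x))
      - lorentz (partialS F (θ x)) (partialT (unitNormal F) (θ x))
        * lorentz (partialT F (θ x)) (partialS (unitNormal F) (θ x))) = 0 := by
    have e1 : partialS G x = _ := hfd x hx (1, 0)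
    have e2 : partialT G x = _ := hfd x hx (0, 1)
    have e3 : partialS (unitNormal G) x = _ := hNfd (1, 0)
    have e4 : partialT (unitNormal G) x = _ := hNfd (0, 1)
    rw [← h0, e1, e2, e3, e4]
    simp only [fderiv_apply_eq F, fderiv_apply_eq (unitNormal F), lorentz_add_left,
      lorentz_add_right, lorentz_smul_left, lorentz_smul_right, hδ]
    ring
  exact (mul_eq_zero.1 key).resolve_left (pow_ne_zero 2 (mul_ne_zero hε0 (hδ0 x hx)))

end IsPatch

/-! ### Ruled patches -/

/-- The partial derivatives of `a(t) c(s) + b(t) v(s)`. -/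
theorem hasFDerivAt_comb {c v : ℝ → Mink4} {a b : ℝ → ℝ} {c' v' : Mink4} {a' b' : ℝ} {x : ℝ × ℝ}
    (hc : HasDerivAt c c' x.1) (hv : HasDerivAt v v' x.1) (ha : HasDerivAt a a' x.2)
    (hb : HasDerivAt b b' x.2) :
    DifferentiableAt ℝ (fun y : ℝ × ℝ => a y.2 • c y.1 + b y.2 • v y.1) x ∧
    fderiv ℝ (fun y : ℝ × ℝ => a y.2 • c y.1 + b y.2 • v y.1) x (1, 0) = a x.2 • c' + b x.2 • v' ∧
    fderiv ℝ (fun y : ℝ × ℝ => a y.2 • c y.1 + b y.2 • v y.1) x (0, 1) =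
      a' • c x.1 + b' • v x.1 := by
  have h1 : HasFDerivAt (fun y : ℝ × ℝ => c y.1) _ x :=
    hc.hasFDerivAt.comp x (hasFDerivAt_fst (p := x))
  have h2 : HasFDerivAt (fun y : ℝ × ℝ => v y.1) _ x :=
    hv.hasFDerivAt.comp x (hasFDerivAt_fst (p := x))
  have h3 : HasFDerivAt (fun y : ℝ × ℝ => a y.2) _ x :=
    ha.hasFDerivAt.comp x (hasFDerivAt_snd (p := x))
  have h4 : HasFDerivAt (fun y : ℝ × ℝ => b y.2) _ x :=
    hb.hasFDerivAt.comp x (hasFDerivAt_snd (p := x))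
  have h := (h3.smul h1).add (h4.smul h2)
  have h' : HasFDerivAt (fun y : ℝ × ℝ => a y.2 • c y.1 + b y.2 • v y.1) _ x := h
  refine ⟨h'.differentiableAt, ?_, ?_⟩ <;> rw [h'.fderiv] <;> simp

section Ruled

variable {F : ℝ × ℝ → Mink4} {c v : ℝ → Mink4} {J : Set ℝ}

theorem ruled_partials (hJ : IsOpen J) (hc : ContDiffOn ℝ ∞ c J) (hv : ContDiffOn ℝ ∞ v J)
    (hF : ∀ x : ℝ × ℝ, x.1 ∈ J → F x = geodesicCurve (c x.1) (v x.1) x.2) {x : ℝ × ℝ}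
    (hx : x.1 ∈ J) :
    partialS F x = Real.cosh x.2 • deriv c x.1 + Real.sinh x.2 • deriv v x.1 ∧
    partialT F x = Real.sinh x.2 • c x.1 + Real.cosh x.2 • v x.1 := by
  have hd : ∀ g : ℝ → Mink4, ContDiffOn ℝ ∞ g J → HasDerivAt g (deriv g x.1) x.1 := fun g hg =>
    ((hg.contDiffAt (hJ.mem_nhds hx)).differentiableAt (by simp)).hasDerivAt
  have he : F =ᶠ[𝓝 x] fun y => Real.cosh y.2 • c y.1 + Real.sinh y.2 • v y.1 :=
    Filter.eventually_of_mem ((hJ.preimage continuous_fst).mem_nhds hx) fun y hy => hF y hy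
  have := hasFDerivAt_comb (hd c hc) (hd v hv) (Real.hasDerivAt_cosh x.2) (Real.hasDerivAt_sinh x.2)
  rw [partialS, partialT, he.fderiv_eq]
  exact this.2

/-- A ruled patch is extrinsically flat exactly where the determinant of `c, v, c', v'`
vanishes: the second fundamental form has no `dt²` part, and its mixed part is that
determinant, up to a nonzero factor. -/
theorem IsPatch.ruled_extCurvature_iff (h : IsPatch F (J ×ˢ Set.univ)) (hJ : IsOpen J)
    (hc : ContDiffOn ℝ ∞ c J) (hv : ContDiffOn ℝ ∞ v J)
    (hF : ∀ x : ℝ × ℝ, x.1 ∈ J → F x = geodesicCurve (c x.1) (v x.1) x.2) {x : ℝ × ℝ}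
    (hx : x.1 ∈ J) :
    extCurvaturePatch F x = 0 ↔ IsFlatJet (c x.1) (v x.1) (deriv c x.1) (deriv v x.1) := by
  have hxU : x ∈ J ×ˢ (Set.univ : Set ℝ) := ⟨hx, trivial⟩
  rw [h.extCurvaturePatch_eq_zero_iff hxU]
  have hd : ∀ g : ℝ → Mink4, ContDiffOn ℝ ∞ g J → HasDerivAt g (deriv g x.1) x.1 := fun g hg =>
    ((hg.contDiffAt (hJ.mem_nhds hx)).differentiableAt (by simp)).hasDerivAt
  have hmem : ∀ᶠ y : ℝ × ℝ in 𝓝 x, y.1 ∈ J := (hJ.preimage continuous_fst).mem_nhds hx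
  have hdc := hc.deriv_of_isOpen (m := ∞) hJ (by simp)
  have hdv := hv.deriv_of_isOpen (m := ∞) hJ (by simp)
  have eS : partialS F =ᶠ[𝓝 x] fun y => Real.cosh y.2 • deriv c y.1 + Real.sinh y.2 • deriv v y.1 :=
    hmem.mono fun y hy => (ruled_partials hJ hc hv hF hy).1
  have eT : partialT F =ᶠ[𝓝 x] fun y => Real.sinh y.2 • c y.1 + Real.cosh y.2 • v y.1 :=
    hmem.mono fun y hy => (ruled_partials hJ hc hv hF hy).2
  have dS := hasFDerivAt_comb (hd _ hdc) (hd _ hdv) (Real.hasDerivAt_cosh x.2)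
    (Real.hasDerivAt_sinh x.2)
  have dT := hasFDerivAt_comb (hd c hc) (hd v hv) (Real.hasDerivAt_sinh x.2)
    (Real.hasDerivAt_cosh x.2)
  have dN := h.differentiableAt_unitNormal hxU
  have oS : ∀ᶠ y in 𝓝 x, lorentz (partialS F y) (unitNormal F y) = 0 := by
    filter_upwards [hmem] with y hy
    rw [h.unitNormal_eq ⟨hy, trivial⟩, lorentz_smul_right, lorentz_comm (partialS F y),
      lorentz_tripleProd_self_mid, mul_zero]
  have oT : ∀ᶠ y in 𝓝 x, lorentz (partialT F y) (unitNormal F y) = 0 := by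
    filter_upwards [hmem] with y hy
    rw [h.unitNormal_eq ⟨hy, trivial⟩, lorentz_smul_right, lorentz_comm (partialT F y),
      lorentz_tripleProd_self_right, mul_zero]
  have hS' : DifferentiableAt ℝ (partialS F) x := eS.differentiableAt_iff.2 dS.1
  have hT' : DifferentiableAt ℝ (partialT F) x := eT.differentiableAt_iff.2 dT.1
  have rST := lorentz_fderiv_add_eq_zero hS' dN oS (0, 1)
  have rTS := lorentz_fderiv_add_eq_zero hT' dN oT (1, 0)
  have rTT := lorentz_fderiv_add_eq_zero hT' dN oT (0, 1)
  rw [eS.fderiv_eq, dS.2.2] at rST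
  rw [eT.fderiv_eq, dT.2.1] at rTS
  rw [eT.fderiv_eq, dT.2.2] at rTT
  have hFN : lorentz (Real.cosh x.2 • c x.1 + Real.sinh x.2 • v x.1) (unitNormal F x) = 0 := by
    have : Real.cosh x.2 • c x.1 + Real.sinh x.2 • v x.1 = F x := (hF x hx).symm
    rw [this, h.unitNormal_eq hxU, lorentz_smul_right, lorentz_comm (F x),
      lorentz_tripleProd_self_left, mul_zero]
  rw [hFN, zero_add] at rTT
  change lorentz _ _ + lorentz _ (partialT (unitNormal F) x) = 0 at rST
  change lorentz _ _ + lorentz _ (partialS (unitNormal F) x) = 0 at rTS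
  change lorentz _ (partialT (unitNormal F) x) = 0 at rTT
  set W := lorentz (Real.sinh x.2 • deriv c x.1 + Real.cosh x.2 • deriv v x.1) (unitNormal F x)
    with hW
  rw [rTT, eq_neg_of_add_eq_zero_right rST, eq_neg_of_add_eq_zero_right rTS]
  have hk : 0 < Real.sqrt (lorentz (tripleProd (F x) (partialS F x) (partialT F x))
      (tripleProd (F x) (partialS F x) (partialT F x))) := by
    rw [Real.sqrt_pos, h.lorentz_cross_self hxU]
    exact h.gram_pos hxU
  have hdet : W = (Real.sqrt (lorentz (tripleProd (F x) (partialS F x) (partialT F x))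
      (tripleProd (F x) (partialS F x) (partialT F x))))⁻¹ *
      -det4 (c x.1) (v x.1) (deriv c x.1) (deriv v x.1) := by
    rw [hW, h.unitNormal_eq hxU, lorentz_smul_right]
    congr 1
    rw [lorentz_comm]
    change det4 _ _ _ _ = _
    rw [(ruled_partials hJ hc hv hF hx).1, (ruled_partials hJ hc hv hF hx).2, hF x hx,
      geodesicCurve, det4_comb, ← sq, ← sq, Real.cosh_sq]
    ring
  have hiff : W = 0 ↔ IsFlatJet (c x.1) (v x.1) (deriv c x.1) (deriv v x.1) := by
    rw [hdet, mul_eq_zero, or_iff_right (inv_ne_zero hk.ne'), neg_eq_zero]; rfl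
  rw [← hiff]
  simp

/-- A family of geodesics `c cosh t + v sinh t` is immersed along one of them exactly when no
tangent vector in the direction of `s` lies in the plane of the geodesic. -/
theorem ruled_immersion_iff (hJ : IsOpen J) (hc : ContDiffOn ℝ ∞ c J) (hv : ContDiffOn ℝ ∞ v J)
    (hu : ∀ s ∈ J, (c s, v s) ∈ UnitTangent3)
    (hF : ∀ x : ℝ × ℝ, x.1 ∈ J → F x = geodesicCurve (c x.1) (v x.1) x.2) {s : ℝ} (hs : s ∈ J) :
    (∀ t, Function.Injective (fderiv ℝ F (s, t))) ↔
      IsImmersedJet (c s) (v s) (deriv c s) (deriv v s) := by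
  obtain ⟨⟨h1, -⟩, h2, h3⟩ := hu s hs
  have h3' := (lorentz_comm (v s) (c s)).trans h3
  simp only at h1 h2 h3
  refine forall_congr' fun t => ?_
  obtain ⟨pS, pT⟩ := ruled_partials hJ hc hv hF (x := (s, t)) hs
  simp only at pS pT
  have hch := Real.cosh_sq t
  have horth : lorentz (geodesicCurve (c s) (v s) t) (partialS F (s, t)) = 0 := by
    have hd : DifferentiableAt ℝ F (s, t) := by
      have hd : ∀ g : ℝ → Mink4, ContDiffOn ℝ ∞ g J → HasDerivAt g (deriv g s) s := fun g hg =>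
        ((hg.contDiffAt (hJ.mem_nhds hs)).differentiableAt (by simp)).hasDerivAt
      have he : F =ᶠ[𝓝 (s, t)] fun y => Real.cosh y.2 • c y.1 + Real.sinh y.2 • v y.1 :=
        Filter.eventually_of_mem ((hJ.preimage continuous_fst).mem_nhds hs) fun y hy => hF y hy
      exact he.differentiableAt_iff.2 (hasFDerivAt_comb (x := (s, t)) (hd c hc) (hd v hv)
        (Real.hasDerivAt_cosh t) (Real.hasDerivAt_sinh t)).1
    have := lorentz_fderiv_add_eq_zero (k := -1) hd hd (Filter.eventually_of_mem
      ((hJ.preimage continuous_fst).mem_nhds hs) fun y hy => by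
        rw [hF y hy]; exact (geodesicCurve_mem_Hyp3 (hu y.1 hy) y.2).1) (1, 0)
    rw [← hF (s, t) hs, partialS]
    linarith [lorentz_comm (F (s, t)) (fderiv ℝ F (s, t) (1, 0))]
  constructor
  · intro hinj k l he
    rw [pS, he, geodesicCurve] at horth
    simp only [lorentz_add_left, lorentz_add_right, lorentz_smul_left, lorentz_smul_right,
      h1, h2, h3, h3'] at horth
    -- the component along `F` vanishes, so the vector is a multiple of `F_t`
    have hm : ((1 : ℝ), Real.sinh t * k - Real.cosh t * l) = (0 : ℝ × ℝ) := by
      apply hinj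
      rw [map_zero, fderiv_apply_eq, pS, pT, he]
      ext i
      simp
      linear_combination -(Real.cosh t * c s i + Real.sinh t * v s i) * horth
        - (k * c s i + l * v s i) * hch
    simpa using congrArg Prod.fst hm
  · intro hne
    rw [injective_iff_map_eq_zero]
    rintro ⟨a, b⟩ he
    rw [fderiv_apply_eq, pS, pT] at he
    simp only at he
    by_cases ha : a = 0
    · rw [ha, zero_smul, zero_add] at he
      have hb : b * b = 0 := by
        have := congrArg (fun z => lorentz z z) he
        simp only [lorentz_add_left, lorentz_add_right, lorentz_smul_left, lorentz_smul_right,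
          h1, h2, h3, h3', lorentz_zero_left] at this
        linear_combination this - b * b * hch
      rw [ha, mul_self_eq_zero.1 hb]; rfl
    · exfalso
      refine hne (-(b / a) * Real.sinh t) (-(b / a) * Real.cosh t) ?_
      have : a⁻¹ • (a • (Real.cosh t • deriv c s + Real.sinh t • deriv v s)) =
          a⁻¹ • -(b • (Real.sinh t • c s + Real.cosh t • v s)) := by
        rw [eq_neg_of_add_eq_zero_left he]
      rw [smul_smul, inv_mul_cancel₀ ha, one_smul] at this
      rw [this]
      ext i
      simp; ring

end Ruled

/-! ### Surfaces and their charts -/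

theorem extCurvaturePatch_congr {F G : ℝ × ℝ → Mink4} {x : ℝ × ℝ} (h : F =ᶠ[𝓝 x] G) :
    extCurvaturePatch F x = extCurvaturePatch G x := by
  have hS : partialS F =ᶠ[𝓝 x] partialS G := h.fderiv.mono fun y hy => by
    rw [partialS, partialS, hy]
  have hT : partialT F =ᶠ[𝓝 x] partialT G := h.fderiv.mono fun y hy => by
    rw [partialT, partialT, hy]
  have hN : unitNormal F =ᶠ[𝓝 x] unitNormal G := by
    filter_upwards [h, hS, hT] with y h1 h2 h3
    rw [unitNormal, unitNormal, h1, h2, h3]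
  have hNS : partialS (unitNormal F) x = partialS (unitNormal G) x := by
    rw [partialS, partialS, hN.fderiv_eq]
  have hNT : partialT (unitNormal F) x = partialT (unitNormal G) x := by
    rw [partialT, partialT, hN.fderiv_eq]
  rw [extCurvaturePatch, extCurvaturePatch, hNS, hNT, hS.eq_of_nhds, hT.eq_of_nhds]

theorem IsPatch.mono {F : ℝ × ℝ → Mink4} {U V : Set (ℝ × ℝ)} (h : IsPatch F U) (hV : IsOpen V)
    (hVU : V ⊆ U) : IsPatch F V :=
  ⟨hV, h.smooth.mono hVU, fun x hx => h.mem_hyp x (hVU hx), fun x hx => h.immersion x (hVU hx)⟩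

section Charts

variable {S : Type*} [TopologicalSpace S] [ChartedSpace (ℝ × ℝ) S]

theorem mdifferentiable_of_mem_maximalAtlas {φ : OpenPartialHomeomorph S (ℝ × ℝ)}
    (hφ : φ ∈ IsManifold.maximalAtlas 𝓘(ℝ, ℝ × ℝ) ∞ S) :
    φ.MDifferentiable 𝓘(ℝ, ℝ × ℝ) 𝓘(ℝ, ℝ × ℝ) :=
  ⟨(contMDiffOn_of_mem_maximalAtlas hφ).mdifferentiableOn (by simp),
    (contMDiffOn_symm_of_mem_maximalAtlas hφ).mdifferentiableOn (by simp)⟩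

theorem IsSurface.isPatch {f : S → Mink4} (hf : IsSurface f) {φ : OpenPartialHomeomorph S (ℝ × ℝ)}
    (hφ : φ ∈ IsManifold.maximalAtlas 𝓘(ℝ, ℝ × ℝ) ∞ S) : IsPatch (f ∘ φ.symm) φ.target where
  isOpen := φ.open_target
  smooth := contMDiffOn_iff_contDiffOn.1
    (hf.smooth.comp_contMDiffOn (contMDiffOn_symm_of_mem_maximalAtlas hφ))
  mem_hyp x _ := hf.mem_hyp _
  immersion x hx := by
    have hd := mdifferentiable_of_mem_maximalAtlas hφ
    have h1 : MDifferentiableAt 𝓘(ℝ, ℝ × ℝ) 𝓘(ℝ, ℝ × ℝ) φ.symm x :=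
      hd.mdifferentiableAt_symm hx
    have h2 : MDifferentiableAt 𝓘(ℝ, ℝ × ℝ) 𝓘(ℝ, Mink4) f (φ.symm x) :=
      (hf.smooth _).mdifferentiableAt (by simp)
    have h3 := mfderiv_comp x h2 h1
    rw [mfderiv_eq_fderiv] at h3
    rw [h3]
    exact (hf.immersion _).comp (hd.symm.mfderiv_injective hx)

variable [IsManifold 𝓘(ℝ, ℝ × ℝ) ∞ S]

/-- Extrinsic flatness can be tested in every chart of the maximal atlas. -/
theorem IsSurface.extCurvaturePatch_eq_zero {f : S → Mink4} (hf : IsSurface f)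
    {φ : OpenPartialHomeomorph S (ℝ × ℝ)}
    (hφ : φ ∈ IsManifold.maximalAtlas 𝓘(ℝ, ℝ × ℝ) ∞ S) {p : S} (hp : p ∈ φ.source)
    (h0 : extCurvature f p = 0) : extCurvaturePatch (f ∘ φ.symm) (φ p) = 0 := by
  set ψ := chartAt (ℝ × ℝ) p with hψdef
  have hψ : ψ ∈ IsManifold.maximalAtlas 𝓘(ℝ, ℝ × ℝ) ∞ S := IsManifold.chart_mem_maximalAtlas p
  have hpψ : p ∈ ψ.source := mem_chart_source _ p
  have hV : IsOpen (ψ.target ∩ ψ.symm ⁻¹' φ.source) := ψ.isOpen_inter_preimage_symm φ.open_source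
  have hθ : ContDiffOn ℝ ∞ (φ ∘ ψ.symm) (ψ.target ∩ ψ.symm ⁻¹' φ.source) :=
    contMDiffOn_iff_contDiffOn.1 ((contMDiffOn_of_mem_maximalAtlas hφ).comp
      ((contMDiffOn_symm_of_mem_maximalAtlas hψ).mono Set.inter_subset_left)
      Set.inter_subset_right)
  have key := (hf.isPatch hφ).extCurvaturePatch_comp
    ((hf.isPatch hψ).mono hV Set.inter_subset_left) hθ
    (fun y hy => φ.map_source hy.2)
    (fun y hy => by simp [φ.left_inv hy.2]) (x := ψ p)
    ⟨ψ.map_source hpψ, by simpa [ψ.left_inv hpψ] using hp⟩ h0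
  simpa [ψ.left_inv hpψ] using key

/-- The shear `(s, t) ↦ (s, t + ρ(s))` of `I × ℝ`. -/
def shear (I : Set ℝ) (hI : IsOpen I) (ρ : ℝ → ℝ) (hρ : ContinuousOn ρ I) :
    OpenPartialHomeomorph (ℝ × ℝ) (ℝ × ℝ) where
  toFun x := (x.1, x.2 + ρ x.1)
  invFun x := (x.1, x.2 - ρ x.1)
  source := I ×ˢ Set.univ
  target := I ×ˢ Set.univ
  map_source' x hx := ⟨hx.1, trivial⟩
  map_target' x hx := ⟨hx.1, trivial⟩
  left_inv' x _ := by simp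
  right_inv' x _ := by simp
  open_source := hI.prod isOpen_univ
  open_target := hI.prod isOpen_univ
  continuousOn_toFun := continuousOn_fst.prodMk
    (continuousOn_snd.add (hρ.comp continuousOn_fst fun x hx => hx.1))
  continuousOn_invFun := continuousOn_fst.prodMk
    (continuousOn_snd.sub (hρ.comp continuousOn_fst fun x hx => hx.1))

/-- Coordinates in which the parameter of the geodesics is shifted by `ρ(s)`. -/
theorem exists_sheared_chart {φ : OpenPartialHomeomorph S (ℝ × ℝ)}
    (hφ : φ ∈ IsManifold.maximalAtlas 𝓘(ℝ, ℝ × ℝ) ∞ S) {I : Set ℝ} (hI : IsOpen I)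
    (hsub : I ×ˢ Set.univ ⊆ φ.target) {ρ : ℝ → ℝ} (hρ : ContDiffOn ℝ ∞ ρ I) :
    ∃ φ' ∈ IsManifold.maximalAtlas 𝓘(ℝ, ℝ × ℝ) ∞ S, φ'.target = I ×ˢ Set.univ ∧
      (∀ p ∈ φ.source, (φ p).1 ∈ I → p ∈ φ'.source) ∧
      ∀ s t, φ'.symm (s, t) = φ.symm (s, t - ρ s) := by
  set e := shear I hI ρ hρ.continuousOn with he
  have hρ1 : ContDiffOn ℝ ∞ (fun x : ℝ × ℝ => ρ x.1) (I ×ˢ Set.univ) :=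
    hρ.comp contDiffOn_fst fun x hx => hx.1
  have h1 : ContDiffOn ℝ ∞ e (I ×ˢ Set.univ) :=
    contDiffOn_fst.prodMk (contDiffOn_snd.add hρ1)
  have h2 : ContDiffOn ℝ ∞ e.symm (I ×ˢ Set.univ) :=
    contDiffOn_fst.prodMk (contDiffOn_snd.sub hρ1)
  have htgt : (φ.trans e).target = I ×ˢ Set.univ := by
    rw [OpenPartialHomeomorph.trans_target]
    exact Set.inter_eq_left.2 fun x hx => hsub (e.map_target hx)
  refine ⟨φ.trans e, ?_, htgt, fun p hp hpI => ?_, fun s t => rfl⟩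
  · rw [IsManifold.mem_maximalAtlas_iff_contMDiffOn]
    constructor
    · refine h1.contMDiffOn.comp ((contMDiffOn_of_mem_maximalAtlas hφ).mono ?_) ?_
      · rw [OpenPartialHomeomorph.trans_source]; exact Set.inter_subset_left
      · rw [OpenPartialHomeomorph.trans_source]; exact Set.inter_subset_right
    · rw [htgt]
      exact (contMDiffOn_symm_of_mem_maximalAtlas hφ).comp h2.contMDiffOn
        fun x hx => hsub (e.map_target hx)
  · rw [OpenPartialHomeomorph.trans_source]
    exact ⟨hp, hpI, trivial⟩

end Charts

section Strip

variable {I : TopologicalSpace.Opens ℝ} {F : ℝ × ℝ → Mink4}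

theorem coe_strip (I : TopologicalSpace.Opens ℝ) :
    (strip I : Set (ℝ × ℝ)) = (I : Set ℝ) ×ˢ Set.univ := by
  ext x; simp [strip]

theorem subtypeCoe_mem_maximalAtlas (U : TopologicalSpace.Opens (ℝ × ℝ)) (hU : Nonempty U) :
    U.openPartialHomeomorphSubtypeCoe hU ∈ IsManifold.maximalAtlas 𝓘(ℝ, ℝ × ℝ) ∞ U := by
  have := StructureGroupoid.subtypeRestr_mem_maximalAtlas (G := contDiffGroupoid ∞ 𝓘(ℝ, ℝ × ℝ))
    (e := OpenPartialHomeomorph.refl (ℝ × ℝ)) (by simp) hU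
  rwa [OpenPartialHomeomorph.subtypeRestr_def, OpenPartialHomeomorph.trans_refl] at this

theorem IsPatch.isSurface (h : IsPatch F (strip I)) : IsSurface (fun x : strip I => F x.1) where
  smooth := h.smooth.contMDiffOn.comp_contMDiff contMDiff_subtype_val fun x => x.2
  mem_hyp x := h.mem_hyp _ x.2
  immersion x := by
    have hd := mdifferentiable_of_mem_maximalAtlas (subtypeCoe_mem_maximalAtlas (strip I) ⟨x⟩)
    have hx : x ∈ ((strip I).openPartialHomeomorphSubtypeCoe ⟨x⟩).source := by simp
    have h1 := hd.mdifferentiableAt hx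
    have h2 : MDifferentiableAt 𝓘(ℝ, ℝ × ℝ) 𝓘(ℝ, Mink4) F x.1 :=
      (h.differentiableAt x.2).mdifferentiableAt
    have h3 := mfderiv_comp x h2 h1
    have h4 : mfderiv 𝓘(ℝ, ℝ × ℝ) 𝓘(ℝ, Mink4) (fun x : strip I => F x.1) x = _ := h3
    rw [h4]
    have h5 : Function.Injective (mfderiv 𝓘(ℝ, ℝ × ℝ) 𝓘(ℝ, Mink4) F x.1) := by
      rw [mfderiv_eq_fderiv]
      exact h.immersion x.1 x.2
    exact h5.comp (hd.mfderiv_injective hx)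

theorem extCurvature_strip (F : ℝ × ℝ → Mink4) (x : strip I) :
    extCurvature (fun x : strip I => F x.1) x = extCurvaturePatch F x.1 := by
  apply extCurvaturePatch_congr
  filter_upwards [TopologicalSpace.Opens.chartAt_subtype_val_symm_eventuallyEq
    (H := ℝ × ℝ) (strip I) (x := x)] with y hy
  exact congrArg F hy.symm

end Strip

/-! ### Families of geodesics -/

theorem geodesicCurve_geodesicCurve (c v : Mink4) (r t : ℝ) :
    geodesicCurve (geodesicCurve c v r) (Real.sinh r • c + Real.cosh r • v) t =
      geodesicCurve c v (t + r) := by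
  simp only [geodesicCurve, Real.cosh_add, Real.sinh_add]
  ext i
  simp; ring

theorem mem_UnitTangent3_geodesicCurve {c v : Mink4} (h : (c, v) ∈ UnitTangent3) (r : ℝ) :
    (geodesicCurve c v r, Real.sinh r • c + Real.cosh r • v) ∈ UnitTangent3 := by
  refine ⟨geodesicCurve_mem_Hyp3 h r, ?_, ?_⟩
  all_goals
    obtain ⟨⟨h1, -⟩, h2, h3⟩ := h
    simp only [geodesicCurve, lorentz_add_left, lorentz_add_right, lorentz_smul_left,
      lorentz_smul_right, lorentz_comm v c] at *
    rw [h1, h2, h3]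
  · linear_combination Real.cosh_sq r
  · ring

theorem Represents.shift {c v : Mink4} {ℓ : OrientedGeodesics}
    (h : Represents (geodesicCurve c v) ℓ) (hu : (c, v) ∈ UnitTangent3) (r : ℝ) :
    Represents (fun t => geodesicCurve c v (t + r)) ℓ := by
  obtain ⟨hg, rfl⟩ := h
  refine ⟨⟨_, _, mem_UnitTangent3_geodesicCurve hu r,
    fun t => (geodesicCurve_geodesicCurve c v r t).symm⟩, Quotient.sound ⟨-r, fun t => ?_⟩⟩
  simp

/-- Smooth families of unit speed geodesics have a smooth frame `(c, v)`. -/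
theorem exists_frame {I : TopologicalSpace.Opens ℝ} {f : ℝ × ℝ → Mink4}
    (hf : ContDiffOn ℝ ∞ f (strip I)) (hg : ∀ s ∈ I, IsUnitSpeedGeodesic fun t => f (s, t)) :
    ∃ c v : ℝ → Mink4, ContDiffOn ℝ ∞ c I ∧ ContDiffOn ℝ ∞ v I ∧
      (∀ s ∈ I, (c s, v s) ∈ UnitTangent3) ∧
      ∀ x : ℝ × ℝ, x.1 ∈ I → f x = geodesicCurve (c x.1) (v x.1) x.2 := by
  have hs1 : Real.sinh 1 ≠ 0 := (Real.sinh_pos_iff.2 one_pos).ne'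
  have hval : ∀ t : ℝ, ContDiffOn ℝ ∞ (fun s => f (s, t)) I := fun t =>
    hf.comp (contDiff_id.prodMk contDiff_const).contDiffOn fun s hs => hs
  have key : ∀ s ∈ I, ∃ p w : Mink4, (p, w) ∈ UnitTangent3 ∧
      (∀ t, f (s, t) = geodesicCurve p w t) ∧ f (s, 0) = p ∧
      (Real.sinh 1)⁻¹ • (f (s, 1) - Real.cosh 1 • f (s, 0)) = w := by
    intro s hs
    obtain ⟨p, w, hpw, he⟩ := hg s hs
    simp only at he
    refine ⟨p, w, hpw, he, ?_, ?_⟩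
    · rw [he 0]; simp [geodesicCurve]
    · rw [he 0, he 1]
      simp [geodesicCurve, smul_smul]
  refine ⟨fun s => f (s, 0), fun s => (Real.sinh 1)⁻¹ • (f (s, 1) - Real.cosh 1 • f (s, 0)),
    hval 0, ((hval 1).sub ((hval 0).const_smul _)).const_smul _, fun s hs => ?_, fun x hx => ?_⟩
  · obtain ⟨p, w, hpw, -, e1, e2⟩ := key s hs
    rw [← e1, ← e2] at hpw
    exact hpw
  · obtain ⟨p, w, -, he, e1, e2⟩ := key x.1 hx
    rw [← e1, ← e2] at he
    exact he x.2

/-- Primitives on an interval of smooth functions, smooth on that interval. -/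
theorem exists_primitive {I : Set ℝ} (hI : IsOpen I) (hc : I.OrdConnected) {g : ℝ → ℝ}
    (hg : ContDiffOn ℝ ∞ g I) : ∃ ρ : ℝ → ℝ, ContDiffOn ℝ ∞ ρ I ∧ ∀ s ∈ I, deriv ρ s = g s := by
  rcases I.eq_empty_or_nonempty with rfl | ⟨s₀, hs₀⟩
  · exact ⟨0, contDiffOn_empty, by simp⟩
  have hd : ∀ s ∈ I, HasDerivAt (fun u => ∫ x in s₀..u, g x) (g s) s := by
    intro s hs
    have hsub : Set.uIcc s₀ s ⊆ I := hc.uIcc_subset hs₀ hs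
    refine intervalIntegral.integral_hasDerivAt_right
      (hg.continuousOn.mono hsub).intervalIntegrable ?_
      (hg.continuousOn.continuousAt (hI.mem_nhds hs))
    exact hg.continuousOn.stronglyMeasurableAtFilter hI s hs
  refine ⟨fun u => ∫ x in s₀..u, g x, ?_, fun s hs => (hd s hs).deriv⟩
  rw [contDiffOn_infty_iff_deriv_of_isOpen hI]
  exact ⟨fun s hs => (hd s hs).differentiableAt.differentiableWithinAt,
    hg.congr fun s hs => (hd s hs).deriv⟩

/-- A smooth family of unit speed geodesics whose jets are flat and immersed is a developable
surface generated by complete geodesics. -/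
theorem isDevelopable_of_jets {I : TopologicalSpace.Opens ℝ} (hI : (I : Set ℝ).OrdConnected)
    {f : ℝ × ℝ → Mink4} {c v : ℝ → Mink4} (hf : ContDiffOn ℝ ∞ f (strip I))
    (hc : ContDiffOn ℝ ∞ c I) (hv : ContDiffOn ℝ ∞ v I)
    (hu : ∀ s ∈ I, (c s, v s) ∈ UnitTangent3)
    (hF : ∀ x : ℝ × ℝ, x.1 ∈ I → f x = geodesicCurve (c x.1) (v x.1) x.2)
    (hjet : ∀ s ∈ I, IsFlatJet (c s) (v s) (deriv c s) (deriv v s) ∧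
      IsImmersedJet (c s) (v s) (deriv c s) (deriv v s)) :
    IsDevelopable (fun x : strip I => f x.1) ∧
      IsRuledByCompleteGeodesics (fun x : strip I => f x.1) := by
  have hpatch : IsPatch f (strip I) :=
    { isOpen := (strip I).isOpen
      smooth := hf
      mem_hyp := fun x hx => by
        rw [hF x hx]; exact geodesicCurve_mem_Hyp3 (hu _ hx) _
      immersion := fun x hx =>
        (ruled_immersion_iff I.isOpen hc hv hu hF hx).2 (hjet x.1 hx).2 x.2 }
  have hruled : IsRuledByCompleteGeodesics (fun x : strip I => f x.1) := by
    intro p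
    -- the shift `ρ` with `ρ' = ⟨c', v⟩` makes the base curve orthogonal to the rulings
    obtain ⟨ρ, hρ, hρ'⟩ := exists_primitive I.isOpen hI
      (contDiffOn_lorentz (hc.deriv_of_isOpen (m := ∞) I.isOpen (by simp)) hv)
    have hne : Nonempty (strip I) := ⟨p⟩
    obtain ⟨φ, hφ, htgt, hsrc, hsymm⟩ := exists_sheared_chart
      (subtypeCoe_mem_maximalAtlas (strip I) hne) I.isOpen (by simp [coe_strip]) hρ
    have hfst : Prod.fst '' φ.target = I := by
      rw [htgt, Set.fst_image_prod _ Set.univ_nonempty]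
    have hch : ContDiffOn ℝ ∞ (fun s => Real.cosh (-ρ s)) I :=
      Real.contDiff_cosh.comp_contDiffOn hρ.neg
    have hsh : ContDiffOn ℝ ∞ (fun s => Real.sinh (-ρ s)) I :=
      Real.contDiff_sinh.comp_contDiffOn hρ.neg
    refine ⟨φ, fun s => geodesicCurve (c s) (v s) (-ρ s),
      fun s => Real.sinh (-ρ s) • c s + Real.cosh (-ρ s) • v s, hsrc p (by simp) p.2,
      ⟨hφ, ?_, ?_, ?_, ?_, ?_⟩, I, I.isOpen, hI, htgt⟩
    · rw [hfst]; exact (hch.smul hc).add (hsh.smul hv)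
    · rw [hfst]; exact (hsh.smul hc).add (hch.smul hv)
    · rw [hfst]; exact fun s hs => mem_UnitTangent3_geodesicCurve (hu s hs) _
    · rw [hfst]
      intro s hs
      have hd : ∀ {E : Type} [NormedAddCommGroup E] [NormedSpace ℝ E] (g : ℝ → E),
          ContDiffOn ℝ ∞ g I → HasDerivAt g (deriv g s) s := fun g hg =>
        ((hg.contDiffAt (I.isOpen.mem_nhds hs)).differentiableAt (by simp)).hasDerivAt
      have hρs := hd ρ hρ
      rw [hρ' s hs] at hρs
      have hder := (hρs.neg.cosh.smul (hd c hc)).add (hρs.neg.sinh.smul (hd v hv))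
      have hder' : HasDerivAt (fun s => geodesicCurve (c s) (v s) (-ρ s)) _ s := hder
      rw [hder'.deriv]
      -- the orthogonality relations of the frame, differentiated
      have horth : ∀ (A B : ℝ → Mink4) (k : ℝ), ContDiffOn ℝ ∞ A I → ContDiffOn ℝ ∞ B I →
          (∀ u ∈ I, lorentz (A u) (B u) = k) →
          lorentz (deriv A s) (B s) + lorentz (A s) (deriv B s) = 0 := by
        intro A B k hA hB hAB
        have h0 := hasDerivAt_pi.1 (hd A hA)
        have h1 := hasDerivAt_pi.1 (hd B hB)
        have h := ((((h0 0).mul (h1 0)).neg.add ((h0 1).mul (h1 1))).add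
          ((h0 2).mul (h1 2))).add ((h0 3).mul (h1 3))
        have h' : HasDerivAt (fun u => lorentz (A u) (B u)) _ s := h
        have hk : (fun u => lorentz (A u) (B u)) =ᶠ[𝓝 s] fun _ => k :=
          Filter.eventually_of_mem (I.isOpen.mem_nhds hs) hAB
        have := h'.unique ((hasDerivAt_const s k).congr_of_eventuallyEq hk)
        simp only [lorentz]
        linarith
      have o1 := horth c c _ hc hc fun u hu' => (hu u hu').1.1
      have o2 := horth v v _ hv hv fun u hu' => (hu u hu').2.1
      have o3 := horth c v _ hc hv fun u hu' => (hu u hu').2.2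
      obtain ⟨⟨h1, -⟩, h2, h3⟩ := hu s hs
      simp only [lorentz_add_left, lorentz_add_right, lorentz_smul_left, lorentz_smul_right,
        lorentz_comm (v s) (c s), lorentz_comm (c s) (deriv c s), lorentz_comm (v s) (deriv v s),
        lorentz_comm (c s) (deriv v s)] at *
      rw [h1, h2, h3]
      have e1 : lorentz (deriv c s) (c s) = 0 := by linarith
      have e2 : lorentz (deriv v s) (v s) = 0 := by linarith
      have e3 : lorentz (deriv v s) (c s) = -lorentz (deriv c s) (v s) := by linarith
      rw [e1, e2, e3]
      ring
    · rintro ⟨s, t⟩ hx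
      rw [htgt] at hx
      have hmem : ((s, t - ρ s) : ℝ × ℝ) ∈
          ((strip I).openPartialHomeomorphSubtypeCoe hne).target := by simpa [coe_strip] using hx.1
      have hval := ((strip I).openPartialHomeomorphSubtypeCoe hne).right_inv hmem
      rw [TopologicalSpace.Opens.openPartialHomeomorphSubtypeCoe_coe] at hval
      rw [hsymm, hval, geodesicCurve_geodesicCurve, ← sub_eq_add_neg]
      exact hF (s, t - ρ s) hx.1
  refine ⟨⟨hpatch.isSurface, fun p => ?_, fun p => ?_⟩, hruled⟩
  · obtain ⟨φ, c, v, h1, h2, -⟩ := hruled p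
    exact ⟨φ, c, v, h1, h2⟩
  · rw [extCurvature_strip]
    rw [coe_strip] at hpatch
    exact (hpatch.ruled_extCurvature_iff I.isOpen hc hv hF p.2).2 (hjet _ p.2).1

/-! ### The jet of a curve of geodesics in coordinates -/

theorem hasDerivAt_rayPlus {z : ℝ → ℂ} {w : ℂ} {s : ℝ} (h : HasDerivAt z w s) :
    HasDerivAt (fun u => rayPlus (z u)) (dRayPlus (z s) w) s := by
  have hre : HasDerivAt (fun u => (z u).re) w.re s :=
    Complex.reCLM.hasFDerivAt.comp_hasDerivAt s h
  have him : HasDerivAt (fun u => (z u).im) w.im s :=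
    Complex.imCLM.hasFDerivAt.comp_hasDerivAt s h
  have hsq := (hre.pow 2).add (him.pow 2)
  rw [hasDerivAt_pi]
  intro i
  fin_cases i
  · convert! (hsq.const_add 1).div_const 2 using 1
    simp [dRayPlus]; ring
  · exact hre
  · exact him
  · convert! (hsq.const_sub 1).div_const 2 using 1
    simp [dRayPlus]; ring

theorem hasDerivAt_rayMinus {z : ℝ → ℂ} {w : ℂ} {s : ℝ} (h : HasDerivAt z w s) :
    HasDerivAt (fun u => rayMinus (z u)) (dRayMinus (z s) w) s := by
  have hre : HasDerivAt (fun u => (z u).re) w.re s :=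
    Complex.reCLM.hasFDerivAt.comp_hasDerivAt s h
  have him : HasDerivAt (fun u => (z u).im) w.im s :=
    Complex.imCLM.hasFDerivAt.comp_hasDerivAt s h
  have hsq := (hre.pow 2).add (him.pow 2)
  rw [hasDerivAt_pi]
  intro i
  fin_cases i
  · convert! (hsq.const_add 1).div_const 2 using 1
    simp [dRayMinus]; ring
  · exact hre.neg
  · exact him.neg
  · convert! (hsq.sub_const 1).div_const 2 using 1
    simp [dRayMinus]; ring

/-- The criterion for null-causal curves, for a frame `(c, v)` of the curve of geodesics and
coordinates after an isometry. -/
theorem jets_iff_nullCausal {c v : ℝ → Mink4} {μ : ℝ → ℂ × ℂ} {a : SL(2, ℂ)} {s₀ : ℝ}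
    (hc : DifferentiableAt ℝ c s₀) (hv : DifferentiableAt ℝ v s₀) (hμ : DifferentiableAt ℝ μ s₀)
    (hu : (c s₀, v s₀) ∈ UnitTangent3)
    (hP : ∀ᶠ s in 𝓝 s₀, ∃ x : ℝ, 0 < x ∧ isomAct a (c s + v s) = x • rayPlus (μ s).2)
    (hM : ∀ᶠ s in 𝓝 s₀, ∃ y : ℝ, 0 < y ∧ isomAct a (c s - v s) = y • rayMinus (μ s).1) :
    IsFlatJet (c s₀) (v s₀) (deriv c s₀) (deriv v s₀) ∧
        IsImmersedJet (c s₀) (v s₀) (deriv c s₀) (deriv v s₀) ↔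
      deriv μ s₀ ≠ 0 ∧ metricIm (μ s₀) (deriv μ s₀) = 0 ∧ metricRe (μ s₀) (deriv μ s₀) ≤ 0 := by
  have hμ1 : HasDerivAt (fun s => (μ s).1) (deriv μ s₀).1 s₀ :=
    (hasFDerivAt_fst (𝕜 := ℝ) (E := ℂ) (F := ℂ)).comp_hasDerivAt s₀ hμ.hasDerivAt
  have hμ2 : HasDerivAt (fun s => (μ s).2) (deriv μ s₀).2 s₀ :=
    (hasFDerivAt_snd (𝕜 := ℝ) (E := ℂ) (F := ℂ)).comp_hasDerivAt s₀ hμ.hasDerivAt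
  have dP : HasDerivAt (fun s => isomAct a (c s + v s)) (isomAct a (deriv c s₀ + deriv v s₀)) s₀ :=
    (isomCLM a).hasFDerivAt.comp_hasDerivAt s₀ (hc.hasDerivAt.add hv.hasDerivAt)
  have dM : HasDerivAt (fun s => isomAct a (c s - v s)) (isomAct a (deriv c s₀ - deriv v s₀)) s₀ :=
    (isomCLM a).hasFDerivAt.comp_hasDerivAt s₀ (hc.hasDerivAt.sub hv.hasDerivAt)
  have dP' := hasDerivAt_pi.1 dP
  have dM' := hasDerivAt_pi.1 dM
  -- the factors are linear functions of the null vectors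
  have hx : ∀ᶠ s in 𝓝 s₀, isomAct a (c s + v s) =
      (isomAct a (c s + v s) 0 + isomAct a (c s + v s) 3) • rayPlus (μ s).2 := by
    filter_upwards [hP] with s hs
    obtain ⟨x, -, e⟩ := hs
    rw [e]
    congr 1
    simp [rayPlus]; ring
  have hy : ∀ᶠ s in 𝓝 s₀, isomAct a (c s - v s) =
      (isomAct a (c s - v s) 0 - isomAct a (c s - v s) 3) • rayMinus (μ s).1 := by
    filter_upwards [hM] with s hs
    obtain ⟨x, -, e⟩ := hs
    rw [e]
    congr 1
    simp [rayMinus]; ring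
  have eP := dP.unique ((((dP' 0).add (dP' 3)).smul
    (hasDerivAt_rayPlus hμ2)).congr_of_eventuallyEq hx)
  have eM := dM.unique ((((dM' 0).sub (dM' 3)).smul
    (hasDerivAt_rayMinus hμ1)).congr_of_eventuallyEq hy)
  obtain ⟨x, hx0, ex⟩ := hP.self_of_nhds
  obtain ⟨y, hy0, ey⟩ := hM.self_of_nhds
  have ex' : isomAct a (c s₀ + v s₀) 0 + isomAct a (c s₀ + v s₀) 3 = x := by
    rw [ex]; simp [rayPlus]; ring
  have ey' : isomAct a (c s₀ - v s₀) 0 - isomAct a (c s₀ - v s₀) 3 = y := by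
    rw [ey]; simp [rayMinus]; ring
  simp only [Pi.add_apply, Pi.sub_apply, ex', ey'] at eP eM
  rw [add_comm (x • _)] at eP
  rw [add_comm (y • _)] at eM
  rw [isomAct_add] at ex eP
  rw [isomAct_sub] at ey eM
  rw [← isFlatJet_isomAct_iff a, ← isImmersedJet_isomAct_iff a]
  exact isFlatJet_and_isImmersedJet_iff
    (coord_mem_domain (mem_UnitTangent3_isomAct a hu) ex ey) hx0 hy0 ex ey eP eM

/-- Smooth families of geodesics that represent a null-causal curve are developable. -/
theorem IsNullCausal.isDevelopable {I : TopologicalSpace.Opens ℝ} {α : ℝ → OrientedGeodesics}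
    (hI : (I : Set ℝ).OrdConnected) (hα : IsNullCausal I α) {f : ℝ × ℝ → Mink4}
    (hf : ContDiffOn ℝ ∞ f (strip I)) (hr : ∀ s ∈ I, Represents (fun t => f (s, t)) (α s)) :
    IsDevelopable (fun x : strip I => f x.1) ∧
      IsRuledByCompleteGeodesics (fun x : strip I => f x.1) := by
  obtain ⟨c, v, hc, hv, hu, hF⟩ := exists_frame hf fun s hs => (hr s hs).1
  refine isDevelopable_of_jets hI hf hc hv hu hF fun s hs => ?_
  obtain ⟨a, μ, hμ, hcoord, h1, h2, h3⟩ := hα s hs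
  have hrays : ∀ᶠ u in 𝓝 s,
      (∃ x : ℝ, 0 < x ∧ isomAct a (c u + v u) = x • rayPlus (μ u).2) ∧
        ∃ y : ℝ, 0 < y ∧ isomAct a (c u - v u) = y • rayMinus (μ u).1 := by
    filter_upwards [hcoord, I.isOpen.mem_nhds hs] with u hu1 hu2
    refine hu1.exists_rays ?_ (hu u hu2)
    have := hr u hu2
    rwa [show (fun t => f (u, t)) = geodesicCurve (c u) (v u) from
      funext fun t => hF (u, t) hu2] at this
  have hd : ∀ g : ℝ → Mink4, ContDiffOn ℝ ∞ g I → DifferentiableAt ℝ g s := fun g hg =>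
    (hg.contDiffAt (I.isOpen.mem_nhds hs)).differentiableAt (by simp)
  exact (jets_iff_nullCausal (hd c hc) (hd v hv) (hμ.differentiableAt (by simp)) (hu s hs)
    (hrays.mono fun _ h => h.1) (hrays.mono fun _ h => h.2)).2 ⟨h1, h2, h3⟩

/-! ### Smooth representatives -/

/-- The unit speed geodesic with null directions `P` (at `+∞`) and `M` (at `-∞`) whose point with
parameter `0` is the closest one to `(1, 0, 0, 0)`. It depends only on the rays of `P` and `M`. -/
noncomputable def canonicalCurve (P M : Mink4) (t : ℝ) : Mink4 :=
  (Real.sqrt (-2 * P 0 * M 0 * lorentz P M))⁻¹ •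
    ((Real.exp t * M 0) • P + (Real.exp (-t) * P 0) • M)

theorem canonicalCurve_smul {x y : ℝ} (hx : 0 < x) (hy : 0 < y) (P M : Mink4) (t : ℝ) :
    canonicalCurve (x • P) (y • M) t = canonicalCurve P M t := by
  have e : -2 * (x • P) 0 * (y • M) 0 * lorentz (x • P) (y • M) =
      (x * y) ^ 2 * (-2 * P 0 * M 0 * lorentz P M) := by
    rw [lorentz_smul_left, lorentz_smul_right]
    simp only [Pi.smul_apply, smul_eq_mul]; ring
  rw [canonicalCurve, e, Real.sqrt_mul (sq_nonneg _), Real.sqrt_sq (by positivity), canonicalCurve]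
  have hxy : x * y ≠ 0 := by positivity
  rw [mul_inv]
  ext i
  simp only [Pi.smul_apply, Pi.add_apply, smul_eq_mul]
  field_simp

theorem canonicalCurve_eq {c v : Mink4} (h : (c, v) ∈ UnitTangent3) (t : ℝ) :
    canonicalCurve (c + v) (c - v) t =
      geodesicCurve c v (t + Real.log ((c - v) 0 / (c + v) 0) / 2) := by
  have hP := end_time_pos h
  have hM := start_time_pos h
  rw [canonicalCurve, lorentz_ends h, geodesicCurve_eq]
  generalize c + v = P at *
  generalize c - v = M at *
  rw [neg_add, Real.exp_add, Real.exp_add, Real.exp_neg (Real.log (M 0 / P 0) / 2)]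
  have hr : Real.exp (Real.log (M 0 / P 0) / 2) = Real.sqrt (M 0) / Real.sqrt (P 0) := by
    rw [← Real.sqrt_div hM.le, ← Real.log_sqrt (by positivity), Real.exp_log (by positivity)]
  have e : -2 * P 0 * M 0 * -2 = 2 ^ 2 * (P 0 * M 0) := by ring
  rw [hr, e, Real.sqrt_mul (by norm_num), Real.sqrt_sq (by norm_num), Real.sqrt_mul hP.le]
  have h1 := Real.sqrt_pos.2 hP
  have h2 := Real.sqrt_pos.2 hM
  have h1' := Real.sq_sqrt hP.le
  have h2' := Real.sq_sqrt hM.le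
  set p := Real.sqrt (P 0)
  set m := Real.sqrt (M 0)
  ext i
  simp only [Pi.smul_apply, Pi.add_apply, smul_eq_mul, ← h1', ← h2']
  field_simp

theorem exists_representative (ℓ : OrientedGeodesics) :
    ∃ u : Mink4 × Mink4, u ∈ UnitTangent3 ∧ Represents (geodesicCurve u.1 u.2) ℓ := by
  obtain ⟨⟨γ, p, w, hpw, he⟩, rfl⟩ := Quotient.exists_rep ℓ
  obtain rfl : γ = geodesicCurve p w := funext he
  exact ⟨(p, w), hpw, _, rfl⟩

theorem contDiffAt_rayPlus {n : WithTop ℕ∞} {z : ℝ → ℂ} {s : ℝ} (h : ContDiffAt ℝ n z s) :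
    ContDiffAt ℝ n (fun u => rayPlus (z u)) s := by
  have hre : ContDiffAt ℝ n (fun u => (z u).re) s := Complex.reCLM.contDiff.contDiffAt.comp s h
  have him : ContDiffAt ℝ n (fun u => (z u).im) s := Complex.imCLM.contDiff.contDiffAt.comp s h
  have hsq := (hre.pow 2).add (him.pow 2)
  rw [contDiffAt_pi]
  intro i
  fin_cases i
  · exact (contDiffAt_const.add hsq).div_const 2
  · exact hre
  · exact him
  · exact (contDiffAt_const.sub hsq).div_const 2

theorem contDiffAt_rayMinus {n : WithTop ℕ∞} {z : ℝ → ℂ} {s : ℝ} (h : ContDiffAt ℝ n z s) :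
    ContDiffAt ℝ n (fun u => rayMinus (z u)) s := by
  have hre : ContDiffAt ℝ n (fun u => (z u).re) s := Complex.reCLM.contDiff.contDiffAt.comp s h
  have him : ContDiffAt ℝ n (fun u => (z u).im) s := Complex.imCLM.contDiff.contDiffAt.comp s h
  have hsq := (hre.pow 2).add (him.pow 2)
  rw [contDiffAt_pi]
  intro i
  fin_cases i
  · exact (contDiffAt_const.add hsq).div_const 2
  · exact hre.neg
  · exact him.neg
  · exact (hsq.sub contDiffAt_const).div_const 2

theorem contDiffAt_canonicalCurve {P M : ℝ → Mink4} {x : ℝ × ℝ} (hP : ContDiffAt ℝ ∞ P x.1)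
    (hM : ContDiffAt ℝ ∞ M x.1) (h0 : -2 * P x.1 0 * M x.1 0 * lorentz (P x.1) (M x.1) ≠ 0)
    (h0' : 0 ≤ -2 * P x.1 0 * M x.1 0 * lorentz (P x.1) (M x.1)) :
    ContDiffAt ℝ ∞ (fun y : ℝ × ℝ => canonicalCurve (P y.1) (M y.1) y.2) x := by
  have hP1 : ContDiffAt ℝ ∞ (fun y : ℝ × ℝ => P y.1) x := hP.comp x contDiffAt_fst
  have hM1 : ContDiffAt ℝ ∞ (fun y : ℝ × ℝ => M y.1) x := hM.comp x contDiffAt_fst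
  have hPi := contDiffAt_pi.1 hP1
  have hMi := contDiffAt_pi.1 hM1
  have hl : ContDiffAt ℝ ∞ (fun y : ℝ × ℝ => lorentz (P y.1) (M y.1)) x := by
    rw [← contDiffWithinAt_univ] at *
    exact ((((hPi 0).mul (hMi 0)).neg.add ((hPi 1).mul (hMi 1))).add
      ((hPi 2).mul (hMi 2))).add ((hPi 3).mul (hMi 3))
  have hrad : ContDiffAt ℝ ∞
      (fun y : ℝ × ℝ => -2 * P y.1 0 * M y.1 0 * lorentz (P y.1) (M y.1)) x :=
    ((contDiffAt_const.mul (hPi 0)).mul (hMi 0)).mul hl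
  have hpos := lt_of_le_of_ne h0' h0.symm
  have he : ContDiffAt ℝ ∞ (fun y : ℝ × ℝ => Real.exp y.2) x :=
    Real.contDiff_exp.contDiffAt.comp x contDiffAt_snd
  have he' : ContDiffAt ℝ ∞ (fun y : ℝ × ℝ => Real.exp (-y.2)) x :=
    Real.contDiff_exp.contDiffAt.comp x contDiffAt_snd.neg
  exact ((hrad.sqrt h0).inv (Real.sqrt_pos.2 hpos).ne').smul
    (((he.mul (hMi 0)).smul hP1).add ((he'.mul (hPi 0)).smul hM1))

/-- A null-causal curve has a smooth family of representatives: the canonical ones. -/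
theorem IsNullCausal.exists_smooth_representative {I : TopologicalSpace.Opens ℝ}
    {α : ℝ → OrientedGeodesics} (hα : IsNullCausal I α) :
    ∃ f : ℝ × ℝ → Mink4, ContDiffOn ℝ ∞ f (strip I) ∧
      ∀ s ∈ I, Represents (fun t => f (s, t)) (α s) := by
  choose u hu hrep using exists_representative
  refine ⟨fun x => canonicalCurve ((u (α x.1)).1 + (u (α x.1)).2)
    ((u (α x.1)).1 - (u (α x.1)).2) x.2, fun x hx => ContDiffAt.contDiffWithinAt ?_,
    fun s _ => ?_⟩
  · obtain ⟨a, μ, hμ, hcoord, -⟩ := hα x.1 hx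
    have hrays := fun s (h : HasCoordinatesAfter a (α s) (μ s)) =>
      h.exists_rays (hrep (α s)) (hu (α s))
    have hμ1 : ContDiffAt ℝ ∞ (fun s => (μ s).1) x.1 := hμ.fst
    have hμ2 : ContDiffAt ℝ ∞ (fun s => (μ s).2) x.1 := hμ.snd
    have hinv : ∀ (N R : Mink4) (k : ℝ), isomAct a N = k • R → N = k • isomAct a⁻¹ R := by
      intro N R k h
      rw [← isomAct_smul, ← h, isomAct_inv_isomAct]
    have key : ContDiffAt ℝ ∞ (fun y : ℝ × ℝ => canonicalCurve (isomAct a⁻¹ (rayPlus (μ y.1).2))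
        (isomAct a⁻¹ (rayMinus (μ y.1).1)) y.2) x := by
      have hpos : 0 < -2 * isomAct a⁻¹ (rayPlus (μ x.1).2) 0 * isomAct a⁻¹ (rayMinus (μ x.1).1) 0 *
          lorentz (isomAct a⁻¹ (rayPlus (μ x.1).2)) (isomAct a⁻¹ (rayMinus (μ x.1).1)) := by
        obtain ⟨⟨p, hp, ep⟩, m, hm, em⟩ := hrays x.1 hcoord.self_of_nhds
        have h1 := end_time_pos (hu (α x.1))
        have h2 := start_time_pos (hu (α x.1))
        have h3 := lorentz_ends (hu (α x.1))
        rw [hinv _ _ _ ep] at h1 h3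
        rw [hinv _ _ _ em] at h2 h3
        rw [lorentz_smul_left, lorentz_smul_right] at h3
        simp only [Pi.smul_apply, smul_eq_mul] at h1 h2
        have h1' := pos_of_mul_pos_right h1 hp.le
        have h2' := pos_of_mul_pos_right h2 hm.le
        have h3' : 0 < -lorentz (isomAct a⁻¹ (rayPlus (μ x.1).2))
            (isomAct a⁻¹ (rayMinus (μ x.1).1)) := by
          refine pos_of_mul_pos_right (a := p * m) ?_ (by positivity)
          linarith
        have := mul_pos (mul_pos h1' h2') h3'
        linarith
      exact contDiffAt_canonicalCurve (P := fun s => isomAct a⁻¹ (rayPlus (μ s).2))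
        (M := fun s => isomAct a⁻¹ (rayMinus (μ s).1))
        ((isomCLM a⁻¹).contDiff.contDiffAt.comp x.1 (contDiffAt_rayPlus hμ2))
        ((isomCLM a⁻¹).contDiff.contDiffAt.comp x.1 (contDiffAt_rayMinus hμ1)) hpos.ne' hpos.le
    refine key.congr_of_eventuallyEq ?_
    filter_upwards [continuousAt_fst.eventually hcoord] with y hy
    obtain ⟨⟨p, hp, ep⟩, m, hm, em⟩ := hrays y.1 hy
    rw [hinv _ _ _ ep, hinv _ _ _ em, canonicalCurve_smul hp hm]
  · simp only [canonicalCurve_eq (hu (α s))]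
    exact (hrep (α s)).shift (hu (α s)) _

/-! ### The explicit surface -/

theorem contDiffOn_geodesicOf {I : TopologicalSpace.Opens ℝ} {μ : ℝ → ℂ × ℂ}
    (hμ : ContDiffOn ℝ ∞ μ I) (h0 : ∀ s ∈ I, 1 + (μ s).1 * conj (μ s).2 ≠ 0) :
    ContDiffOn ℝ ∞ (fun x : ℝ × ℝ => geodesicOf (μ x.1) x.2) (strip I) := by
  have hfst : ContDiffOn ℝ ∞ (Prod.fst : ℝ × ℝ → ℝ) (strip I) := contDiffOn_fst
  have hmaps : Set.MapsTo (Prod.fst : ℝ × ℝ → ℝ) (strip I) I := fun x hx => hx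
  have hP : ContDiffOn ℝ ∞ (fun s => rayPlus (μ s).2) I := fun s hs =>
    (contDiffAt_rayPlus (hμ.contDiffAt (I.isOpen.mem_nhds hs)).snd).contDiffWithinAt
  have hM : ContDiffOn ℝ ∞ (fun s => rayMinus (μ s).1) I := fun s hs =>
    (contDiffAt_rayMinus (hμ.contDiffAt (I.isOpen.mem_nhds hs)).fst).contDiffWithinAt
  have hD : ContDiffOn ℝ ∞ (fun s => ‖1 + (μ s).1 * conj (μ s).2‖⁻¹) I :=
    ((contDiffOn_const.add (hμ.fst.mul
      (Complex.conjCLE.contDiff.comp_contDiffOn hμ.snd))).norm ℝ h0).inv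
      fun s hs => norm_ne_zero_iff.2 (h0 s hs)
  have he : ContDiffOn ℝ ∞ (fun x : ℝ × ℝ => Real.exp x.2) (strip I) :=
    Real.contDiff_exp.comp_contDiffOn contDiffOn_snd
  have he' : ContDiffOn ℝ ∞ (fun x : ℝ × ℝ => Real.exp (-x.2)) (strip I) :=
    Real.contDiff_exp.comp_contDiffOn contDiffOn_snd.neg
  refine ContDiffOn.congr ?_ fun x _ => geodesicOf_eq (μ x.1) x.2
  exact (hD.comp hfst hmaps).smul
    ((he.smul (hP.comp hfst hmaps)).add (he'.smul (hM.comp hfst hmaps)))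

/-- A null-causal curve in the coordinate domain is a null-causal curve of oriented geodesics. -/
theorem IsNullCausalCoord.isNullCausal {I : TopologicalSpace.Opens ℝ} {μ : ℝ → ℂ × ℂ}
    (hμ : IsNullCausalCoord I μ) {α : ℝ → OrientedGeodesics} {a : SL(2, ℂ)}
    (hα : ∀ s ∈ I, HasCoordinatesAfter a (α s) (μ s)) : IsNullCausal I α := fun s hs =>
  ⟨a, μ, hμ.smooth.contDiffAt (I.isOpen.mem_nhds hs),
    Filter.eventually_of_mem (I.isOpen.mem_nhds hs) hα, hμ.regular s hs, hμ.null_im s hs,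
    hμ.causal_re s hs⟩

theorem IsNullCausalCoord.isDevelopable {I : TopologicalSpace.Opens ℝ} {μ : ℝ → ℂ × ℂ}
    (hI : (I : Set ℝ).OrdConnected) (hμ : IsNullCausalCoord I μ) :
    IsDevelopable (fun x : strip I => geodesicOf (μ x.1.1) x.1.2) ∧
      IsRuledByCompleteGeodesics (fun x : strip I => geodesicOf (μ x.1.1) x.1.2) := by
  classical
  -- outside of `I` the value does not matter
  have h0 : (1 : ℂ) + ((0 : ℂ), (0 : ℂ)).1 * conj ((0 : ℂ), (0 : ℂ)).2 ≠ 0 := by simp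
  let α : ℝ → OrientedGeodesics := fun s =>
    if h : 1 + (μ s).1 * conj (μ s).2 ≠ 0 then
      Quotient.mk geodesicSetoid ⟨geodesicOf (μ s), isUnitSpeedGeodesic_geodesicOf h⟩
    else Quotient.mk geodesicSetoid ⟨_, isUnitSpeedGeodesic_geodesicOf h0⟩
  have hrep : ∀ s ∈ I, Represents (geodesicOf (μ s)) (α s) := by
    intro s hs
    have h := hμ.mem_domain s hs
    have e : α s = Quotient.mk geodesicSetoid ⟨_, isUnitSpeedGeodesic_geodesicOf h⟩ := dif_pos h
    exact e ▸ ⟨isUnitSpeedGeodesic_geodesicOf h, rfl⟩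
  refine (hμ.isNullCausal (α := α) (a := 1) fun s hs => ⟨_, hrep s hs, ?_⟩).isDevelopable hI
    (f := fun x => geodesicOf (μ x.1) x.2) (contDiffOn_geodesicOf hμ.smooth hμ.mem_domain) hrep
  simp only [isomAct_one]
  exact hasCoordinates_geodesicOf (hμ.mem_domain s hs)

/-! ### Developable surfaces come from null-causal curves -/

/-- Every geodesic can be moved into the coordinate domain by an isometry. -/
theorem exists_isom_into_domain {c v : Mink4} (h : (c, v) ∈ UnitTangent3) :
    ∃ b : SL(2, ℂ), 0 < isomAct b (c + v) 0 + isomAct b (c + v) 3 ∧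
      0 < isomAct b (c - v) 0 - isomAct b (c - v) 3 := by
  have hP := lorentz_end_self h
  have hM := lorentz_start_self h
  have hPM := lorentz_ends h
  have hP0 := end_time_pos h
  have hM0 := start_time_pos h
  generalize c + v = P at *
  generalize c - v = M at *
  simp only [lorentz] at hP hM hPM
  have hP3 : 0 ≤ P 0 + P 3 ∧ 0 ≤ P 0 - P 3 := by
    constructor <;> nlinarith [sq_nonneg (P 1), sq_nonneg (P 2)]
  have hM3 : 0 ≤ M 0 - M 3 := by
    nlinarith [sq_nonneg (M 1), sq_nonneg (M 2)]
  by_cases hm : M 0 - M 3 = 0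
  · -- `γ₋ = ∞`: exchange `0` and `∞`
    have hM12 : M 1 ^ 2 + M 2 ^ 2 = 0 := by
      have : M 3 = M 0 := by linarith
      rw [this] at hM; linarith
    have hM1 : M 1 = 0 := by nlinarith [sq_nonneg (M 1), sq_nonneg (M 2)]
    have hM2 : M 2 = 0 := by nlinarith [sq_nonneg (M 1), sq_nonneg (M 2)]
    have hPm : 0 < P 0 - P 3 := by
      refine lt_of_le_of_ne hP3.2 fun h0 => ?_
      have h3 : P 3 = P 0 := by linarith
      have h4 : M 3 = M 0 := by linarith
      rw [hM1, hM2, h3, h4] at hPM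
      linarith
    refine ⟨⟨!![0, 1; -1, 0], by simp [Matrix.det_fin_two]⟩, ?_, ?_⟩
    · simp [isomAct, ofHerm, toHerm, Matrix.mul_apply, Fin.sum_univ_two,
        Matrix.conjTranspose_apply, Matrix.vecHead, Matrix.vecTail]
      linarith
    · simp [isomAct, ofHerm, toHerm, Matrix.mul_apply, Fin.sum_univ_two,
        Matrix.conjTranspose_apply, Matrix.vecHead, Matrix.vecTail]
      linarith
  · have hm' : 0 < M 0 - M 3 := lt_of_le_of_ne hM3 (Ne.symm hm)
    by_cases hp : P 0 + P 3 = 0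
    · -- `γ₊ = 0`: translate
      have hP12 : P 1 ^ 2 + P 2 ^ 2 = 0 := by
        have : P 3 = -P 0 := by linarith
        rw [this] at hP; linarith
      have hP1 : P 1 = 0 := by nlinarith [sq_nonneg (P 1), sq_nonneg (P 2)]
      have hP2 : P 2 = 0 := by nlinarith [sq_nonneg (P 1), sq_nonneg (P 2)]
      refine ⟨⟨!![1, 1; 0, 1], by simp [Matrix.det_fin_two]⟩, ?_, ?_⟩
      · simp [isomAct, ofHerm, toHerm, Matrix.mul_apply, Fin.sum_univ_two,
          Matrix.conjTranspose_apply, Matrix.vecHead, Matrix.vecTail, hP1, hP2]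
        linarith
      · simp [isomAct, ofHerm, toHerm, Matrix.mul_apply, Fin.sum_univ_two,
          Matrix.conjTranspose_apply, Matrix.vecHead, Matrix.vecTail]
        linarith
    · refine ⟨1, ?_, ?_⟩
      · rw [isomAct_one]; exact lt_of_le_of_ne hP3.1 (Ne.symm hp)
      · rw [isomAct_one]; exact hm'

/-- A null vector with positive coefficient `x = P₀ + P₃` is `x` times a standard one. -/
theorem eq_smul_rayPlus {P : Mink4} (hP : lorentz P P = 0) (h : 0 < P 0 + P 3) :
    P = (P 0 + P 3) • rayPlus ((P 1 : ℂ) / (P 0 + P 3 : ℝ) + (P 2 : ℂ) / (P 0 + P 3 : ℝ) *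
      Complex.I) := by
  simp only [lorentz] at hP
  have e : P 0 - P 3 = (P 1 ^ 2 + P 2 ^ 2) / (P 0 + P 3) := by
    rw [eq_div_iff h.ne']; linarith
  have hx := h.ne'
  rw [← Complex.ofReal_div, ← Complex.ofReal_div]
  generalize hk : P 0 + P 3 = k at *
  have e0 : P 0 = (k + (P 1 ^ 2 + P 2 ^ 2) / k) / 2 := by linarith
  have e3 : P 3 = (k - (P 1 ^ 2 + P 2 ^ 2) / k) / 2 := by linarith
  ext i
  fin_cases i <;> simp [rayPlus]
  · rw [e0]; field_simp
  · field_simp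
  · field_simp
  · rw [e3]; field_simp

theorem eq_smul_rayMinus {M : Mink4} (hM : lorentz M M = 0) (h : 0 < M 0 - M 3) :
    M = (M 0 - M 3) • rayMinus (-((M 1 : ℂ) / (M 0 - M 3 : ℝ) + (M 2 : ℂ) / (M 0 - M 3 : ℝ) *
      Complex.I)) := by
  simp only [lorentz] at hM
  have e : M 0 + M 3 = (M 1 ^ 2 + M 2 ^ 2) / (M 0 - M 3) := by
    rw [eq_div_iff h.ne']; linarith
  have hx := h.ne'
  rw [← Complex.ofReal_div, ← Complex.ofReal_div]
  generalize hk : M 0 - M 3 = k at *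
  have e0 : M 0 = (k + (M 1 ^ 2 + M 2 ^ 2) / k) / 2 := by linarith
  have e3 : M 3 = ((M 1 ^ 2 + M 2 ^ 2) / k - k) / 2 := by linarith
  ext i
  fin_cases i <;> simp [rayMinus]
  · rw [e0]; field_simp
  · field_simp
  · field_simp
  · rw [e3]; field_simp

/-- Near every point, a smooth frame `(c, v)` has, after an isometry, smooth coordinates, and the
curves `c cosh t + v sinh t` are the explicit ones up to a smooth shift. -/
theorem exists_local_coordinates {J : Set ℝ} (hJ : IsOpen J) {c v : ℝ → Mink4}
    (hc : ContDiffOn ℝ ∞ c J) (hv : ContDiffOn ℝ ∞ v J)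
    (hu : ∀ s ∈ J, (c s, v s) ∈ UnitTangent3) {s₀ : ℝ} (hs₀ : s₀ ∈ J) :
    ∃ (b : SL(2, ℂ)) (I : TopologicalSpace.Opens ℝ) (μ : ℝ → ℂ × ℂ) (ρ : ℝ → ℝ),
      s₀ ∈ I ∧ (I : Set ℝ) ⊆ J ∧ (I : Set ℝ).OrdConnected ∧ ContDiffOn ℝ ∞ μ I ∧
      ContDiffOn ℝ ∞ ρ I ∧
      (∀ s ∈ I, ∃ x : ℝ, 0 < x ∧ isomAct b (c s + v s) = x • rayPlus (μ s).2) ∧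
      (∀ s ∈ I, ∃ y : ℝ, 0 < y ∧ isomAct b (c s - v s) = y • rayMinus (μ s).1) ∧
      ∀ s ∈ I, ∀ t, isomAct b (geodesicCurve (c s) (v s) t) = geodesicOf (μ s) (t + ρ s) := by
  obtain ⟨b, hbP, hbM⟩ := exists_isom_into_domain (hu s₀ hs₀)
  have hP : ContDiffOn ℝ ∞ (fun s => isomAct b (c s + v s)) J :=
    (isomCLM b).contDiff.comp_contDiffOn (hc.add hv)
  have hM : ContDiffOn ℝ ∞ (fun s => isomAct b (c s - v s)) J :=
    (isomCLM b).contDiff.comp_contDiffOn (hc.sub hv)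
  have hPi := contDiffOn_pi.1 hP
  have hMi := contDiffOn_pi.1 hM
  set P := fun s => isomAct b (c s + v s) with hPdef
  set M := fun s => isomAct b (c s - v s) with hMdef
  have hx : ContDiffOn ℝ ∞ (fun s => P s 0 + P s 3) J := (hPi 0).add (hPi 3)
  have hy : ContDiffOn ℝ ∞ (fun s => M s 0 - M s 3) J := (hMi 0).sub (hMi 3)
  have hnear : ∀ᶠ s in 𝓝 s₀, 0 < P s 0 + P s 3 ∧ 0 < M s 0 - M s 3 ∧ s ∈ J :=
    ((hx.continuousOn.continuousAt (hJ.mem_nhds hs₀)).eventually (lt_mem_nhds hbP)).and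
      (((hy.continuousOn.continuousAt (hJ.mem_nhds hs₀)).eventually (lt_mem_nhds hbM)).and
        (hJ.mem_nhds hs₀))
  obtain ⟨ε, hε, hball⟩ := Metric.eventually_nhds_iff_ball.1 hnear
  have hsub : Metric.ball s₀ ε ⊆ J := fun s hs => (hball s hs).2.2
  have hx0 : ∀ s ∈ Metric.ball s₀ ε, 0 < P s 0 + P s 3 := fun s hs => (hball s hs).1
  have hy0 : ∀ s ∈ Metric.ball s₀ ε, 0 < M s 0 - M s 3 := fun s hs => (hball s hs).2.1
  have hofReal : ∀ g : ℝ → ℝ, ContDiffOn ℝ ∞ g (Metric.ball s₀ ε) →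
      ContDiffOn ℝ ∞ (fun s => (g s : ℂ)) (Metric.ball s₀ ε) := fun g hg =>
    Complex.ofRealCLM.contDiff.comp_contDiffOn hg
  have hquot : ∀ f g h : ℝ → ℝ, ContDiffOn ℝ ∞ f J → ContDiffOn ℝ ∞ g J → ContDiffOn ℝ ∞ h J →
      (∀ s ∈ Metric.ball s₀ ε, 0 < h s) →
      ContDiffOn ℝ ∞ (fun s => (f s : ℂ) / (h s : ℝ) + (g s : ℂ) / (h s : ℝ) * Complex.I)
        (Metric.ball s₀ ε) := by
    intro f g h hf hg hh h0
    have h1 := hofReal _ ((hf.mono hsub).div (hh.mono hsub) fun s hs => (h0 s hs).ne')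
    have h2 := hofReal _ ((hg.mono hsub).div (hh.mono hsub) fun s hs => (h0 s hs).ne')
    refine (h1.add (h2.mul (contDiffOn_const (c := Complex.I)))).congr fun s _ => ?_
    simp
  have hrayP : ∀ s ∈ Metric.ball s₀ ε, isomAct b (c s + v s) = (P s 0 + P s 3) • rayPlus
      ((P s 1 : ℂ) / (P s 0 + P s 3 : ℝ) + (P s 2 : ℂ) / (P s 0 + P s 3 : ℝ) * Complex.I) :=
    fun s hs => eq_smul_rayPlus
      ((lorentz_isomAct b _ _).trans (lorentz_end_self (hu s (hsub hs)))) (hx0 s hs)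
  have hrayM : ∀ s ∈ Metric.ball s₀ ε, isomAct b (c s - v s) = (M s 0 - M s 3) • rayMinus
      (-((M s 1 : ℂ) / (M s 0 - M s 3 : ℝ) + (M s 2 : ℂ) / (M s 0 - M s 3 : ℝ) * Complex.I)) :=
    fun s hs => eq_smul_rayMinus
      ((lorentz_isomAct b _ _).trans (lorentz_start_self (hu s (hsub hs)))) (hy0 s hs)
  refine ⟨b, ⟨Metric.ball s₀ ε, Metric.isOpen_ball⟩, fun s =>
    (-((M s 1 : ℂ) / (M s 0 - M s 3 : ℝ) + (M s 2 : ℂ) / (M s 0 - M s 3 : ℝ) * Complex.I),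
      (P s 1 : ℂ) / (P s 0 + P s 3 : ℝ) + (P s 2 : ℂ) / (P s 0 + P s 3 : ℝ) * Complex.I),
    fun s => Real.log ((P s 0 + P s 3) / (M s 0 - M s 3)) / 2,
    Metric.mem_ball_self hε, hsub, ?_, ?_, ?_, ?_, ?_, ?_⟩
  · change (Metric.ball s₀ ε).OrdConnected
    rw [Real.ball_eq_Ioo]
    exact Set.ordConnected_Ioo
  · exact (hquot _ _ _ (hMi 1) (hMi 2) hy hy0).neg.prodMk (hquot _ _ _ (hPi 1) (hPi 2) hx hx0)
  · exact (((hx.mono hsub).div (hy.mono hsub) fun s hs => (hy0 s hs).ne').log fun s hs =>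
      (div_pos (hx0 s hs) (hy0 s hs)).ne').div_const 2
  · exact fun s hs => ⟨_, hx0 s hs, hrayP s hs⟩
  · exact fun s hs => ⟨_, hy0 s hs, hrayM s hs⟩
  · intro s hs t
    rw [isomAct_geodesicCurve]
    exact geodesicCurve_eq_geodesicOf (μ := (_, _)) (mem_UnitTangent3_isomAct b (hu s (hsub hs)))
      (hx0 s hs) (hy0 s hs) ((isomAct_add _ _ _).symm.trans (hrayP s hs))
      ((isomAct_sub _ _ _).symm.trans (hrayM s hs)) t

/-- A developable surface generated by complete geodesics is locally given by a null-causal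
curve. -/
theorem IsDevelopable.exists_nullCausal {S : Type*} [TopologicalSpace S]
    [ChartedSpace (ℝ × ℝ) S] [IsManifold 𝓘(ℝ, ℝ × ℝ) ∞ S] {f : S → Mink4} (hf : IsDevelopable f)
    (hr : IsRuledByCompleteGeodesics f) (p : S) :
    ∃ φ ∈ IsManifold.maximalAtlas 𝓘(ℝ, ℝ × ℝ) ∞ S,
      ∃ (I : TopologicalSpace.Opens ℝ) (α : ℝ → OrientedGeodesics) (a : SL(2, ℂ)) (μ : ℝ → ℂ × ℂ),
        p ∈ φ.source ∧ (I : Set ℝ).OrdConnected ∧ φ.target = strip I ∧ IsNullCausal I α ∧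
        (∀ s ∈ I, Represents (fun t => f (φ.symm (s, t))) (α s)) ∧ IsNullCausalCoord I μ ∧
        ∀ s ∈ I, ∀ t : ℝ, f (φ.symm (s, t)) = isomAct a (geodesicOf (μ s) t) := by
  classical
  obtain ⟨φ, c, v, hp, hφ, J, hJ, -, htgt⟩ := hr p
  have hfst : Prod.fst '' φ.target = J := by
    rw [htgt, Set.fst_image_prod _ Set.univ_nonempty]
  have hc := hφ.smooth_base
  have hv := hφ.smooth_dir
  have hu := hφ.unit
  rw [hfst] at hc hv hu
  have hpJ : (φ p).1 ∈ J := by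
    have := φ.map_source hp
    rw [htgt] at this
    exact this.1
  have hF : ∀ x : ℝ × ℝ, x.1 ∈ J → (f ∘ φ.symm) x = geodesicCurve (c x.1) (v x.1) x.2 :=
    fun x hx => hφ.eq x (by rw [htgt]; exact ⟨hx, trivial⟩)
  have hpatch : IsPatch (f ∘ φ.symm) (J ×ˢ Set.univ) := htgt ▸ hf.surface.isPatch hφ.chart
  have hjet : ∀ s ∈ J, IsFlatJet (c s) (v s) (deriv c s) (deriv v s) ∧
      IsImmersedJet (c s) (v s) (deriv c s) (deriv v s) := by
    intro s hs
    have hmem : ∀ t, ((s, t) : ℝ × ℝ) ∈ φ.target := fun t => by rw [htgt]; exact ⟨hs, trivial⟩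
    constructor
    · have h0 := hf.surface.extCurvaturePatch_eq_zero hφ.chart (φ.map_target (hmem 0))
        (hf.flat _)
      rw [φ.right_inv (hmem 0)] at h0
      exact (hpatch.ruled_extCurvature_iff hJ hc hv hF (x := (s, 0)) hs).1 h0
    · exact (ruled_immersion_iff hJ hc hv hu hF hs).1
        fun t => hpatch.immersion _ ⟨hs, trivial⟩
  obtain ⟨b, I, μ, ρ, hpI, hIJ, hI, hμ, hρ, hrP, hrM, hgeo⟩ :=
    exists_local_coordinates hJ hc hv hu hpJ
  have hcoord : IsNullCausalCoord I μ := by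
    have hdiff : ∀ s ∈ I, deriv μ s ≠ 0 ∧ metricIm (μ s) (deriv μ s) = 0 ∧
        metricRe (μ s) (deriv μ s) ≤ 0 := by
      intro s hs
      have hd : ∀ g : ℝ → Mink4, ContDiffOn ℝ ∞ g J → DifferentiableAt ℝ g s := fun g hg =>
        (hg.contDiffAt (hJ.mem_nhds (hIJ hs))).differentiableAt (by simp)
      exact (jets_iff_nullCausal (hd c hc) (hd v hv)
        ((hμ.contDiffAt (I.isOpen.mem_nhds hs)).differentiableAt (by simp)) (hu s (hIJ hs))
        (Filter.eventually_of_mem (I.isOpen.mem_nhds hs) hrP)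
        (Filter.eventually_of_mem (I.isOpen.mem_nhds hs) hrM)).1 (hjet s (hIJ hs))
    refine ⟨hμ, fun s hs => ?_, fun s hs => (hdiff s hs).1, fun s hs => (hdiff s hs).2.1,
      fun s hs => (hdiff s hs).2.2⟩
    obtain ⟨x, -, ex⟩ := hrP s hs
    obtain ⟨y, -, ey⟩ := hrM s hs
    exact coord_mem_domain (mem_UnitTangent3_isomAct b (hu s (hIJ hs)))
      ((isomAct_add _ _ _).symm.trans ex) ((isomAct_sub _ _ _).symm.trans ey)
  obtain ⟨φ', hφ', htgt', hsrc', hsymm'⟩ := exists_sheared_chart hφ.chart I.isOpen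
    (htgt ▸ Set.prod_mono hIJ subset_rfl) hρ
  have hval : ∀ s ∈ I, ∀ t, f (φ'.symm (s, t)) = geodesicCurve (c s) (v s) (t - ρ s) := by
    intro s hs t
    rw [hsymm']
    exact hF (s, t - ρ s) (hIJ hs)
  have hformula : ∀ s ∈ I, ∀ t, f (φ'.symm (s, t)) = isomAct b⁻¹ (geodesicOf (μ s) t) := by
    intro s hs t
    rw [hval s hs, ← isomAct_inv_isomAct b (geodesicCurve _ _ _), hgeo s hs, sub_add_cancel]
  have hunit : ∀ s ∈ I, IsUnitSpeedGeodesic fun t => f (φ'.symm (s, t)) := by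
    intro s hs
    refine ⟨_, _, mem_UnitTangent3_geodesicCurve (hu s (hIJ hs)) (-ρ s), fun t => ?_⟩
    rw [geodesicCurve_geodesicCurve, ← sub_eq_add_neg]
    exact hval s hs t
  let α : ℝ → OrientedGeodesics := fun s =>
    if h : s ∈ I then Quotient.mk geodesicSetoid ⟨_, hunit s h⟩
    else Quotient.mk geodesicSetoid ⟨_, hunit _ hpI⟩
  have hα : ∀ s ∈ I, Represents (fun t => f (φ'.symm (s, t))) (α s) := by
    intro s hs
    have e : α s = Quotient.mk geodesicSetoid ⟨_, hunit s hs⟩ := dif_pos hs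
    exact e ▸ ⟨hunit s hs, rfl⟩
  refine ⟨φ', hφ', I, α, b⁻¹, μ, hsrc' p hp hpI, hI, htgt'.trans (coe_strip I).symm, ?_, hα,
    hcoord, hformula⟩
  refine hcoord.isNullCausal (a := b) fun s hs => ⟨_, hα s hs, ?_⟩
  simp only [hformula s hs, isomAct_isomAct_inv]
  exact hasCoordinates_geodesicOf (hcoord.mem_domain s hs)

theorem theoremA :
    -- the explicit map of a null-causal curve in the coordinate domain
    (∀ (I : TopologicalSpace.Opens ℝ) (μ : ℝ → ℂ × ℂ), (I : Set ℝ).OrdConnected →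
      IsNullCausalCoord I μ →
        (∀ s ∈ I, IsUnitSpeedGeodesic (geodesicOf (μ s)) ∧
          HasCoordinates (geodesicOf (μ s)) (μ s)) ∧
        IsDevelopable (fun x : strip I => geodesicOf (μ x.1.1) x.1.2) ∧
        IsRuledByCompleteGeodesics (fun x : strip I => geodesicOf (μ x.1.1) x.1.2)) ∧
    -- null-causal curves in the whole space of oriented geodesics
    (∀ (I : TopologicalSpace.Opens ℝ) (α : ℝ → OrientedGeodesics), (I : Set ℝ).OrdConnected →
      IsNullCausal I α →
        (∃ f : ℝ × ℝ → Mink4, ContDiffOn ℝ ∞ f (strip I) ∧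
          ∀ s ∈ I, Represents (fun t => f (s, t)) (α s)) ∧
        ∀ f : ℝ × ℝ → Mink4, ContDiffOn ℝ ∞ f (strip I) →
          (∀ s ∈ I, Represents (fun t => f (s, t)) (α s)) →
            IsDevelopable (fun x : strip I => f x.1) ∧
            IsRuledByCompleteGeodesics (fun x : strip I => f x.1)) ∧
    -- the converse
    (∀ (S : Type*) [TopologicalSpace S] [ChartedSpace (ℝ × ℝ) S]
      [IsManifold 𝓘(ℝ, ℝ × ℝ) ∞ S] (f : S → Mink4),
      IsDevelopable f → IsRuledByCompleteGeodesics f →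
        ∀ p : S, ∃ φ ∈ IsManifold.maximalAtlas 𝓘(ℝ, ℝ × ℝ) ∞ S,
          ∃ (I : TopologicalSpace.Opens ℝ) (α : ℝ → OrientedGeodesics) (a : SL(2, ℂ))
            (μ : ℝ → ℂ × ℂ),
            p ∈ φ.source ∧ (I : Set ℝ).OrdConnected ∧ φ.target = strip I ∧
            IsNullCausal I α ∧
            (∀ s ∈ I, Represents (fun t => f (φ.symm (s, t))) (α s)) ∧
            IsNullCausalCoord I μ ∧
            ∀ s ∈ I, ∀ t : ℝ, f (φ.symm (s, t)) = isomAct a (geodesicOf (μ s) t)) := by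
  refine ⟨fun I μ hI hμ => ⟨fun s hs => ?_, hμ.isDevelopable hI⟩, fun I α hI hα =>
    ⟨hα.exists_smooth_representative, fun f hf hr => hα.isDevelopable hI hf hr⟩, ?_⟩
  · exact ⟨isUnitSpeedGeodesic_geodesicOf (hμ.mem_domain s hs),
      hasCoordinates_geodesicOf (hμ.mem_domain s hs)⟩
  · intro S _ _ _ f hf hr p
    exact hf.exists_nullCausal hr p
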